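/- **Setting.** For a partition $\mu=(\mu_1\ge\mu_2\ge\dots)$ let $l(\mu)$ be its number of parts, $|\mathrm{Aut}\,\mu|=\prod_i m_i!$ where $m_i$ is the number of parts equal to $i$, and $2\mu=(2\mu_1,2\mu_2,\dots)$. For partitions $\lambda,\mu$ of $d$ let $\chi^\lambda_\mu$ be the value of the irreducible character of $S_d$ attached to $\lambda$ at permutations of cycle type $\mu$, and let $$p_k(\lambda)=\sum_{i\ge1}\Big(\big(\lambda_i-i+\tfrac12\big)^k-\big(-i+\tfrac12\big)^k\Big).$$ For partitions $\alpha,\beta$ of $d\ge 1$ and $g\ge0$, $r\ge1$, $s\ge0$ with $rs=2g-2+l(\alpha)+l(\beta)$, the double Hurwitz number with completed $(r+1)$-cycles is $$H^{g,(r)}_{\alpha,\beta}=\frac{1}{\prod_i\alpha_i\prod_j\beta_j}\sum_{\lambda\vdash d}\chi^\lambda_\alpha\Big(\frac{p_{r+1}(\lambda)}{(r+1)!}\Big)^s\chi^\lambda_\beta .$$ **Statement.** Let $g\ge0$, let $n\ge1$ be odd, and put $s=g+\frac{n-1}{2}$. There is a unique polynomial in $\mathbb{Q}[\beta_1,\dots,\beta_n]$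 whose value at every vector $(\beta_1,\dots,\beta_n)$ of positive integers is $d\,H^{g,(2)}_{(d),\beta}/s!$, where $d=\beta_1+\dots+\beta_n$ and, on the Hurwitz side, $\beta$ stands for the partition of $d$ with parts $\beta_1,\dots,\beta_n$. For integers $b_1,\dots,b_n\ge0$ with $b_1+\dots+b_n=3g+\frac{n-1}{2}$, let the top-degree combinatorial Hodge integral $\langle\langle\tau_{b_1}\cdots\tau_{b_n}\rangle\rangle_g$ be the coefficient of $\beta_1^{b_1}\cdots\beta_n^{b_n}$ in this polynomial. Then $$\langle\langle\tau_{b_1}\cdots\tau_{b_n}\rangle\rangle_g=\frac{1}{2^{3g+\frac{n-1}{2}}}\sum_{h=0}^{g}\frac{(2s-2h)!}{h!\,(s-h)!\,3^h}\sum_{\lambda\vdash g-h}\ \sum_{\vec a\in D_{2g-2h}(\vec b)}\frac{\xi_{2\lambda}\,R_{2\lambda,P_{\vec a}}}{|\mathrm{Aut}\,\lambda|}\binom{g+\frac{n-1}{2}+2h}{b_1-a_1,\dots,b_n-a_n}.$$ Here: - $\xi_{2j}=[x^{2j}]\log(\sinh x/x)$ for $j\geq 1$, and $\xi_{2\lambda}=\xi_{2\lambda_1}\xi_{2\lambda_2}\cdots$;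 - $D_{2j}(\vec b)$ is the set of vectors $(a_1,\dots,a_n)$ of even non-negative integers with $a_i\le b_i$ and $a_1+\dots+a_n=2j$; - $P_{\vec a}$ is the partition whose parts are the nonzero components of $\vec a$; - $R_{\lambda\mu}$ are the coefficients in the expansion $\prod_i\big(\sum_k x_k^{\lambda_i}\big)=\sum_{\mu\vdash|\lambda|}R_{\lambda\mu}\,m_\mu$ of power sums in monomial symmetric functions $m_\mu$; equivalently, $R_{\lambda\mu}$ is the number of ordered set partitions $(A_1,\dots,A_{l(\mu)})$ of $\{1,\dots,l(\lambda)\}$ with $\mu_j=\sum_{i\in A_j}\lambda_i$ for all $j$. -/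

import Mathlib

open scoped Nat

noncomputable section

namespace HurwitzHodge

/-! ### Partitions -/

/-- The parts `μ₁ ≥ μ₂ ≥ … ≥ μ_l` of a partition, as a list. -/
def partList {d : ℕ} (μ : Nat.Partition d) : List ℕ := μ.parts.sort (· ≥ ·)

/-- The length `l(μ)`. -/
def len {d : ℕ} (μ : Nat.Partition d) : ℕ := Multiset.card μ.parts

/-- `|Aut μ| = m₁! m₂! ⋯`, where `mᵢ` is the number of parts equal to `i`. -/
def autCard {d : ℕ} (μ : Nat.Partition d) : ℕ :=
  ∏ i ∈ μ.parts.toFinset, (μ.parts.count i)!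

/-- The partition `2μ = (2μ₁, 2μ₂, …)`. -/
def double {d : ℕ} (μ : Nat.Partition d) : Nat.Partition (2 * d) where
  parts := μ.parts.map (2 * ·)
  parts_pos := by
    intro i hi
    obtain ⟨j, hj, rfl⟩ := Multiset.mem_map.1 hi
    have := μ.parts_pos hj
    omega
  parts_sum := by rw [Multiset.sum_map_mul_left, Multiset.map_id', μ.parts_sum]

/-- The partition obtained by rearranging the components of a vector (zero components, which
are not parts of a partition, are dropped). -/
def ofVec {n : ℕ} (a : Fin n → ℕ) : Nat.Partition (∑ i, a i) :=
  Nat.Partition.ofSums _ (Finset.univ.val.map a) rfl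

/-! ### Irreducible characters of the symmetric group -/

theorem partList_sorted {d : ℕ} (μ : Nat.Partition d) : (partList μ).SortedGE :=
  (Multiset.pairwise_sort _ _).sortedGE

theorem partList_coe {d : ℕ} (μ : Nat.Partition d) : (partList μ : Multiset ℕ) = μ.parts :=
  Multiset.sort_eq _ _

/-- The Young diagram with row lengths `μ₁ ≥ μ₂ ≥ …`. -/
def diagram {d : ℕ} (μ : Nat.Partition d) : YoungDiagram :=
  YoungDiagram.ofRowLens (partList μ) (partList_sorted μ)

theorem card_cellsOfRowLens (w : List ℕ) : (YoungDiagram.cellsOfRowLens w).card = w.sum := by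
  induction w with
  | nil => rfl
  | cons a w ih =>
    rw [YoungDiagram.cellsOfRowLens, Finset.card_union_of_disjoint, Finset.card_map, ih]
    · simp
    · rw [Finset.disjoint_left]
      rintro ⟨i, j⟩ h1 h2
      simp only [Finset.mem_product, Finset.mem_singleton, Finset.mem_map] at h1 h2
      obtain ⟨⟨c1, c2⟩, -, hc⟩ := h2
      have := congrArg Prod.fst hc
      simp at this
      omega

theorem card_diagram {d : ℕ} (μ : Nat.Partition d) :
    Fintype.card {c // c ∈ (diagram μ).cells} = d := by
  rw [Fintype.card_coe]
  change (YoungDiagram.cellsOfRowLens (partList μ)).card = d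
  rw [card_cellsOfRowLens, ← Multiset.sum_coe, partList_coe, μ.parts_sum]

/-- A fixed tableau of shape `μ`: a numbering of the cells of the diagram by `Fin d`. (The
isomorphism class of the representation below does not depend on the numbering.) -/
def tableau {d : ℕ} (μ : Nat.Partition d) : Fin d ≃ {c // c ∈ (diagram μ).cells} :=
  (Fintype.equivFinOfCardEq (card_diagram μ)).symm

/-- Permutations that preserve every row of the tableau. -/
def rowPerms {d : ℕ} (μ : Nat.Partition d) : Finset (Equiv.Perm (Fin d)) :=
  {σ | ∀ i, (tableau μ (σ i)).1.1 = (tableau μ i).1.1}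

/-- Permutations that preserve every column of the tableau. -/
def colPerms {d : ℕ} (μ : Nat.Partition d) : Finset (Equiv.Perm (Fin d)) :=
  {σ | ∀ i, (tableau μ (σ i)).1.2 = (tableau μ i).1.2}

/-- The Young symmetrizer `c_μ = (∑_{p} p) (∑_{q} sgn(q) q)`, with `p` running over the row
group and `q` over the column group. -/
def youngSymmetrizer {d : ℕ} (μ : Nat.Partition d) : MonoidAlgebra ℚ (Equiv.Perm (Fin d)) :=
  (∑ p ∈ rowPerms μ, MonoidAlgebra.of ℚ _ p) *
    ∑ q ∈ colPerms μ, ((Equiv.Perm.sign q : ℤ) : ℚ) • MonoidAlgebra.of ℚ _ q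

/-- The underlying space of the irreducible representation attached to `μ`: the left ideal
`ℚ[S_d] c_μ`. -/
abbrev spechtIdeal {d : ℕ} (μ : Nat.Partition d) :
    Ideal (MonoidAlgebra ℚ (Equiv.Perm (Fin d))) :=
  Ideal.span {youngSymmetrizer μ}

/-- The irreducible representation of `S_d` attached to `μ`: left multiplication on
`ℚ[S_d] c_μ`. -/
def spechtRep {d : ℕ} (μ : Nat.Partition d) :
    Representation ℚ (Equiv.Perm (Fin d)) (spechtIdeal μ) :=
  Representation.ofModule' (spechtIdeal μ)

theorem exists_perm_parts {d : ℕ} (μ : Nat.Partition d) :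
    ∃ σ : Equiv.Perm (Fin d), σ.partition.parts = μ.parts := by
  have hsplit := Multiset.filter_add_not (fun i => 2 ≤ i) μ.parts
  have hones : μ.parts.filter (fun i => ¬ 2 ≤ i) =
      Multiset.replicate (Multiset.card (μ.parts.filter (fun i => ¬ 2 ≤ i))) 1 := by
    rw [Multiset.eq_replicate]
    refine ⟨rfl, fun i hi => ?_⟩
    have h1 := Multiset.mem_filter.1 hi
    have := μ.parts_pos h1.1
    omega
  have hsum := congrArg Multiset.sum hsplit
  rw [Multiset.sum_add, μ.parts_sum, hones, Multiset.sum_replicate, smul_eq_mul, mul_one] at hsum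
  obtain ⟨σ, hσ⟩ := (Equiv.Perm.exists_with_cycleType_iff (Fin d)
    (m := μ.parts.filter (fun i => 2 ≤ i))).2
      ⟨by rw [Fintype.card_fin]; omega, fun a ha => (Multiset.mem_filter.1 ha).2⟩
  refine ⟨σ, ?_⟩
  rw [Equiv.Perm.parts_partition, ← Equiv.Perm.sum_cycleType, hσ, Fintype.card_fin]
  conv_rhs => rw [← hsplit, hones]
  congr 2
  omega

/-- The value `χ^μ_ν` of the irreducible character attached to `μ` at the permutations of cycle
type `ν`. -/
def irrChar {d : ℕ} (μ ν : Nat.Partition d) : ℚ :=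
  (spechtRep μ).character (exists_perm_parts ν).choose

/-- The choice of the permutation in `irrChar` does not matter. -/
theorem irrChar_eq {d : ℕ} (μ ν : Nat.Partition d) (σ : Equiv.Perm (Fin d))
    (hσ : σ.partition.parts = ν.parts) : irrChar μ ν = (spechtRep μ).character σ := by
  have h : IsConj σ (exists_perm_parts ν).choose := by
    rw [Equiv.Perm.partition_eq_of_isConj]
    exact Nat.Partition.ext (hσ.trans (exists_perm_parts ν).choose_spec.symm)
  obtain ⟨c, hc⟩ := isConj_iff.1 h
  rw [irrChar, ← hc, mul_assoc, Representation.char_mul_comm, mul_assoc, inv_mul_cancel, mul_one]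

/-! ### Double Hurwitz numbers with completed cycles -/

/-- The shifted symmetric power sum
`p_k(μ) = ∑_{i ≥ 1} ((μ_i - i + 1/2)^k - (-i + 1/2)^k)`; the terms with `i > l(μ)` vanish, and
the row index `i` below starts from `0`. -/
def shiftedPowerSum (k : ℕ) {d : ℕ} (μ : Nat.Partition d) : ℚ :=
  ∑ i : Fin (partList μ).length,
    ((((partList μ).get i : ℚ) - ((i : ℕ) + 1) + 1 / 2) ^ k - (-((i : ℕ) + 1 : ℚ) + 1 / 2) ^ k)

/-- The disconnected double Hurwitz number with completed `(r+1)`-cycles,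
`H^{g,(r)}_{α,β} = (∏ αᵢ ∏ βⱼ)⁻¹ ∑_{μ ⊢ d} χ^μ_α (p_{r+1}(μ) / (r+1)!)^s χ^μ_β`,
where `r s = 2g - 2 + l(α) + l(β)` (it is considered only if such an `s` exists). -/
def doubleHurwitz (g r : ℕ) {d : ℕ} (α β : Nat.Partition d) : ℚ :=
  1 / ((α.parts.prod : ℚ) * (β.parts.prod : ℚ)) *
    ∑ μ : Nat.Partition d,
      irrChar μ α * (shiftedPowerSum (r + 1) μ / ((r + 1)! : ℚ)) ^ ((2 * g + len α + len β - 2) / r)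
        * irrChar μ β

/-! ### Combinatorial Hodge integrals -/

/-- `P` is the polynomial `d H^{g,(2)}_{(d),β} / s!` in the parts `β₁, …, βₙ`, where
`d = β₁ + ⋯ + βₙ` and `s = g + (n-1)/2`. -/
def IsHurwitzPolynomial (g n : ℕ) (P : MvPolynomial (Fin n) ℚ) : Prop :=
  ∀ β : Fin n → ℕ, (∀ i, 0 < β i) →
    MvPolynomial.eval (fun i => (β i : ℚ)) P =
      ((∑ i, β i : ℕ) : ℚ) *
        doubleHurwitz g 2 (Nat.Partition.indiscrete (∑ i, β i)) (ofVec β) /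
          ((g + (n - 1) / 2)! : ℚ)

open Classical in
/-- The polynomial `d H^{g,(2)}_{(d),β} / s!` in `β₁, …, βₙ` (with the value `0` if there were
none). -/
def hurwitzPolynomial (g n : ℕ) : MvPolynomial (Fin n) ℚ :=
  if h : ∃ P, IsHurwitzPolynomial g n P then h.choose else 0

/-- The combinatorial Hodge integral `⟨⟨τ_{b₁} ⋯ τ_{bₙ} Λ_{2k}⟩⟩_g`, that is
`(-1)^k [β₁^{b₁} ⋯ βₙ^{bₙ}] (d H^{g,(2)}_{(d),β} / s!)`; it vanishes unless
`b₁ + ⋯ + bₙ + 2k = 3g + (n-1)/2`. -/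
def combHodge (g k : ℕ) {n : ℕ} (b : Fin n → ℕ) : ℚ :=
  if ∑ i, b i + 2 * k = 3 * g + (n - 1) / 2 then
    (-1) ^ k * (hurwitzPolynomial g n).coeff (Finsupp.equivFunOnFinite.symm b)
  else 0

/-- The Witten term `⟨⟨τ_{b₁} ⋯ τ_{bₙ}⟩⟩_g = ⟨⟨τ_{b₁} ⋯ τ_{bₙ} Λ₀⟩⟩_g`. -/
def wittenTerm (g : ℕ) {n : ℕ} (b : Fin n → ℕ) : ℚ := combHodge g 0 b

/-! ### The ingredients of the closed formula -/

/-- The power series `sinh x / x`. -/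
def sinhDivX : PowerSeries ℚ :=
  PowerSeries.mk fun m => if Even m then 1 / ((m + 1)! : ℚ) else 0

theorem X_mul_sinhDivX :
    PowerSeries.X * sinhDivX =
      PowerSeries.C (1 / 2 : ℚ) * (PowerSeries.exp ℚ - PowerSeries.evalNegHom (PowerSeries.exp ℚ)) := by
  ext m
  rw [PowerSeries.coeff_C_mul, map_sub, PowerSeries.evalNegHom, PowerSeries.coeff_rescale]
  cases m with
  | zero => simp
  | succ m =>
    rw [mul_comm, PowerSeries.coeff_succ_mul_X, sinhDivX, PowerSeries.coeff_mk,
      PowerSeries.coeff_exp]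
    by_cases hm : Even m
    · rw [if_pos hm, (Even.add_one hm).neg_one_pow]
      simp
      ring
    · rw [if_neg hm, (Nat.not_even_iff_odd.1 hm).add_one.neg_one_pow]
      simp

/-- `ξ_m = [x^m] log (sinh x / x)`. -/
def xi (m : ℕ) : ℚ := PowerSeries.coeff m (PowerSeries.logOf sinhDivX)

/-- `ξ_μ = ξ_{μ₁} ξ_{μ₂} ⋯`. -/
def xiPart {d : ℕ} (μ : Nat.Partition d) : ℚ := (μ.parts.map xi).prod

/-- `R_{λμ}`: the coefficients of the expansion of the power sum `P_λ` in monomial symmetric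
functions (see `psumPart_eq_sum_msymm`). It is the number of ordered set partitions
`(A₁, …, A_{l(μ)})` of `{1, …, l(λ)}` with `μ_j = ∑_{i ∈ A_j} λ_i` for all `j`, the ordered set
partition being given by the map `f` with `A_j = f⁻¹(j)`. -/
def R {k l : ℕ} (lam : Nat.Partition k) (mu : Nat.Partition l) : ℕ :=
  Fintype.card {f : Fin (partList lam).length → Fin (partList mu).length //
    ∀ j, ∑ i with f i = j, (partList lam).get i = (partList mu).get j}

theorem exists_equiv_of_map_eq {α β : Type*} [Fintype α] [Fintype β] (f : α → ℕ) (g : β → ℕ)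
    (h : Finset.univ.val.map f = Finset.univ.val.map g) : ∃ e : α ≃ β, ∀ a, g (e a) = f a := by
  classical
  have hc : ∀ c, Fintype.card {a // f a = c} = Fintype.card {b // g b = c} := by
    intro c
    have := congrArg (Multiset.count c) h
    rw [Multiset.count_map, Multiset.count_map] at this
    rw [Fintype.card_subtype, Fintype.card_subtype]
    simpa [Finset.card, eq_comm] using this
  exact ⟨Equiv.ofFiberEquiv fun c => Fintype.equivOfCardEq (hc c),
    fun a => Equiv.ofFiberEquiv_map _ a⟩

theorem card_maps_eq {σ : Type*} [Fintype σ] [DecidableEq σ] (w v : List ℕ)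
    (hw : ∀ x ∈ w, 0 < x) (s : Multiset σ)
    (hv : s.dedup.map (fun x => s.count x) = (v : Multiset ℕ)) :
    Fintype.card {f : Fin w.length → σ // ∀ x, ∑ i with f i = x, w.get i = s.count x} =
      Fintype.card {f : Fin w.length → Fin v.length //
        ∀ j, ∑ i with f i = j, w.get i = v.get j} := by
  classical
  obtain ⟨e, he⟩ := exists_equiv_of_map_eq v.get (fun x : {x // x ∈ s.toFinset} => s.count x.1) (by
    have h2 : Finset.univ.val.map v.get = (v : Multiset ℕ) := by simp [Fin.univ_def]
    have h5 : (Finset.univ : Finset {x // x ∈ s.toFinset}).val.map (fun x => s.count x.1) =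
        ((Finset.univ : Finset {x // x ∈ s.toFinset}).val.map Subtype.val).map
          (fun x => s.count x) := by
      rw [Multiset.map_map]; rfl
    rw [h2, ← hv, h5]
    congr 1
    exact (Multiset.attach_map_val _).symm)
  symm
  refine Fintype.card_congr (Equiv.ofBijective (fun f => ⟨fun i => (e (f.1 i)).1, ?_⟩) ⟨?_, ?_⟩)
  · intro x
    by_cases hx : x ∈ s.toFinset
    · obtain ⟨j, hj⟩ := e.surjective ⟨x, hx⟩
      have h := f.2 j
      rw [← he j, hj] at h
      rw [← h]
      refine Finset.sum_congr (Finset.filter_congr fun i _ => ?_) fun _ _ => rfl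
      rw [← e.apply_eq_iff_eq, hj, Subtype.ext_iff]
    · rw [Multiset.count_eq_zero_of_notMem (fun h => hx (Multiset.mem_toFinset.2 h))]
      refine Finset.sum_eq_zero fun i hi => ?_
      exact absurd ((Finset.mem_filter.1 hi).2 ▸ (e (f.1 i)).2) hx
  · intro f₁ f₂ h
    ext i
    have := congrFun (congrArg Subtype.val h) i
    rw [e.injective (Subtype.ext this)]
  · intro f
    have hmem : ∀ i, f.1 i ∈ s.toFinset := by
      intro i
      rw [Multiset.mem_toFinset, ← Multiset.count_pos, ← f.2 (f.1 i)]
      exact lt_of_lt_of_le (hw _ (List.get_mem w i))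
        (Finset.single_le_sum (f := w.get) (fun _ _ => Nat.zero_le _)
          (Finset.mem_filter.2 ⟨Finset.mem_univ i, rfl⟩))
    refine ⟨⟨fun i => e.symm ⟨f.1 i, hmem i⟩, fun j => ?_⟩, ?_⟩
    · rw [← he j, ← f.2]
      refine Finset.sum_congr (Finset.filter_congr fun i _ => ?_) fun _ _ => rfl
      rw [Equiv.symm_apply_eq, Subtype.ext_iff]
    · ext i
      simp

theorem partList_pos {d : ℕ} (μ : Nat.Partition d) : ∀ x ∈ partList μ, 0 < x := fun _ hx =>
  μ.parts_pos ((Multiset.mem_sort _).1 hx)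

/-- `P_λ = ∑_{μ ⊢ |λ|} R_{λμ} m_μ`, in any finite set of variables. -/
theorem psumPart_eq_sum_msymm (σ : Type*) [Fintype σ] [DecidableEq σ] {k : ℕ}
    (lam : Nat.Partition k) :
    MvPolynomial.psumPart σ ℚ lam =
      ∑ mu : Nat.Partition k, (R lam mu : ℚ) • MvPolynomial.msymm σ ℚ mu := by
  classical
  set w := partList lam with hwdef
  have hwsum : ∑ i, w.get i = k := by
    rw [← lam.parts_sum, ← partList_coe, Multiset.sum_coe, ← hwdef]
    simp
  let S : (Fin w.length → σ) → Sym σ k := fun f =>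
    ⟨∑ i, Multiset.replicate (w.get i) (f i), by simpa using hwsum⟩
  have hcount : ∀ f x, (S f).1.count x = ∑ i with f i = x, w.get i := by
    intro f x
    simp only [S]
    rw [Multiset.count_sum', Finset.sum_filter]
    simp [Multiset.count_replicate]
  have hL : MvPolynomial.psumPart σ ℚ lam = ∑ f : Fin w.length → σ,
      (((S f).1.map MvPolynomial.X).prod : MvPolynomial σ ℚ) := by
    have h1 : MvPolynomial.psumPart σ ℚ lam = ∏ i : Fin w.length, MvPolynomial.psum σ ℚ (w.get i) := by
      rw [MvPolynomial.psumPart, ← partList_coe, Multiset.map_coe, Multiset.prod_coe, ← hwdef]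
      simp
    rw [h1]
    simp only [MvPolynomial.psum]
    rw [Finset.prod_univ_sum, Fintype.piFinset_univ]
    refine Finset.sum_congr rfl fun f _ => ?_
    simp only [S]
    rw [← Multiset.coe_mapAddMonoidHom, map_sum, Multiset.prod_sum]
    simp
  have hR : ∀ s : Sym σ k, (Finset.univ.filter fun f => S f = s).card =
      R lam (Nat.Partition.ofSym s) := by
    intro s
    rw [R, ← card_maps_eq w _ (partList_pos lam) s.1 (by rw [partList_coe]; rfl),
      Fintype.card_subtype]
    congr 1
    refine Finset.filter_congr fun f _ => ?_
    exact ⟨fun h x => by rw [← hcount, h],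
      fun h => Subtype.ext (Multiset.ext.2 fun x => (hcount f x).trans (h x))⟩
  have h6 : ∀ mu : Nat.Partition k, (R lam mu : ℚ) • MvPolynomial.msymm σ ℚ mu =
      ∑ s : Sym σ k with Nat.Partition.ofSym s = mu,
        (R lam (Nat.Partition.ofSym s) : ℚ) • ((s.1.map MvPolynomial.X).prod : MvPolynomial σ ℚ) := by
    intro mu
    rw [MvPolynomial.msymm, Finset.smul_sum]
    rw [Finset.sum_subtype (p := fun s : Sym σ k => Nat.Partition.ofSym s = mu) _ (by simp)]
    exact Finset.sum_congr rfl fun s _ => by rw [s.2]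
  rw [Finset.sum_congr rfl fun mu _ => h6 mu, Finset.sum_fiberwise, hL,
    ← Finset.sum_fiberwise Finset.univ S]
  refine Finset.sum_congr rfl fun s _ => ?_
  rw [← hR s, Finset.sum_congr rfl (g := fun _ =>
    ((s.1.map MvPolynomial.X).prod : MvPolynomial σ ℚ)) (fun f hf => by
      rw [(Finset.mem_filter.1 hf).2]), Finset.sum_const, Nat.cast_smul_eq_nsmul]

/-- `D_m(b)`: the vectors `a` with even components, `a_i ≤ b_i`, and `a₁ + ⋯ + aₙ = m`. -/
def D (m : ℕ) {n : ℕ} (b : Fin n → ℕ) : Finset (Fin n → ℕ) :=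
  {a ∈ Fintype.piFinset fun i => Finset.range (b i + 1) |
    (∀ i, Even (a i)) ∧ ∑ i, a i = m}

end HurwitzHodge

end

/-!
Let `S_d` act on the subsets of `{1, …, d}`. Summing `(-X) ^ |S|` times the sign of `g` on `S` over
the subsets `S` stable under `g` gives `∏ (1 - X ^ βᵢ)`, where `β` is the cycle type of `g`.
Consecutive hooks split the signed module of `k`-element subsets, so the character of the hook with
leg `k` is `(-1) ^ k` times the coefficient of `X ^ k` in `∏ (1 - X ^ βᵢ) / (1 - X)`. Hence the sum
of `(-1) ^ k χ` over the hooks is supported on the `d`-cycles, and by orthogonality the characters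
of all other shapes vanish there: only hooks contribute to `H_{(d),β}`.

Since `p₃ / 3! = (d ^ 3 / 3 + d * (d - 1 - 2 * k) ^ 2) / 8` on the hook with leg `k`, the Hurwitz
number is a combination of power sums of the `d - 1 - 2 * k` weighted by these characters. Their
exponential generating function is, up to an elementary factor, `∏ sinh (βᵢ x) / (βᵢ x)` divided by
`sinh x / x`, whose coefficients are polynomials in `β`. In top degree the division by `sinh x / x`
disappears, and the exponential formula applied to `exp (∑ᵢ log (sinh (βᵢ x) / (βᵢ x)))` expands
the remaining product in the power sums of `β`, whose monomial coefficients are the numbers `R`.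
-/

namespace HurwitzHodge

/-! ### Characters of left ideals of a group algebra -/

section ModuleCharacter

open Representation
open scoped MonoidAlgebra

variable {k G : Type*} [Field k] [Group G]

theorem ofModule'_apply {M : Type*} [AddCommGroup M] [Module k M] [Module k[G] M]
    [IsScalarTower k k[G] M] (g : G) (x : M) :
    ofModule' (k := k) M g x = MonoidAlgebra.of k G g • x := by
  simp [ofModule']

/-- The character of the representation of `G` over `k` on a `k[G]`-module. -/
noncomputable def moduleChar (M : Type*) [AddCommGroup M] [Module k M] [Module k[G] M]
    [IsScalarTower k k[G] M] (g : G) : k :=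
  (ofModule' (k := k) M).character g

variable {M N P : Type*} [AddCommGroup M] [AddCommGroup N] [AddCommGroup P]
  [Module k M] [Module k N] [Module k P] [Module k[G] M] [Module k[G] N] [Module k[G] P]
  [IsScalarTower k k[G] M] [IsScalarTower k k[G] N] [IsScalarTower k k[G] P]

theorem moduleChar_congr (e : M ≃ₗ[k[G]] N) (g : G) :
    moduleChar (k := k) M g = moduleChar N g := by
  have hconj : (e.restrictScalars k).conj (ofModule' M g) = ofModule' N g :=
    LinearMap.ext fun x => by
      simp [LinearEquiv.conj_apply, -MonoidAlgebra.of_apply, ofModule'_apply]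
  rw [moduleChar, moduleChar, character, character, ← hconj, LinearMap.trace_conj']

theorem moduleChar_prod [FiniteDimensional k M] [FiniteDimensional k N] (g : G) :
    moduleChar (k := k) (M × N) g = moduleChar M g + moduleChar N g := by
  have hprod : ofModule' (k := k) (M × N) g = (ofModule' M g).prodMap (ofModule' N g) :=
    LinearMap.ext fun x => by simp only [ofModule'_apply, LinearMap.prodMap_apply]; rfl
  rw [moduleChar, character, hprod, LinearMap.trace_prodMap']
  rfl

theorem moduleChar_eq_add_of_exact [Finite G] [NeZero (Nat.card G : k)] [FiniteDimensional k M]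
    [FiniteDimensional k P] {i : M →ₗ[k[G]] N} {f : N →ₗ[k[G]] P} (hi : Function.Injective i)
    (hf : Function.Surjective f) (h : Function.Exact i f) (g : G) :
    moduleChar (k := k) N g = moduleChar M g + moduleChar P g := by
  obtain ⟨l, hl⟩ := IsSemisimpleModule.extension_property i hi LinearMap.id
  rw [moduleChar_congr (h.splitInjectiveEquiv hf ⟨l, hl⟩).1, moduleChar_prod]

theorem sum_moduleChar_mul_inv_eq_zero [Fintype G] [NeZero (Nat.card G : k)]
    [FiniteDimensional k M] [FiniteDimensional k N] [Subsingleton (M →ₗ[k[G]] N)] :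
    ∑ g : G, moduleChar (k := k) N g * moduleChar M g⁻¹ = 0 := by
  have hcard : (Nat.card G : k) ≠ 0 := NeZero.ne _
  have : Invertible (Nat.card G : k) := invertibleOfNonzero hcard
  have hsub : Subsingleton (IntertwiningMap (ofModule' (k := k) (G := G) M) (ofModule' N)) := by
    refine subsingleton_of_forall_eq 0 fun T => ?_
    let T' : M →ₗ[k[G]] N := MonoidAlgebra.equivariantOfLinearOfComm T.toLinearMap fun g x => by
      simpa [ofModule'_apply] using LinearMap.congr_fun (T.isIntertwining' g) x
    exact IntertwiningMap.ext
      (LinearMap.ext fun x => LinearMap.congr_fun (Subsingleton.elim T' 0) x)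
  have horth := card_inv_mul_sum_char_mul_char_eq_finrank
    (ofModule' (k := k) (G := G) M) (ofModule' (k := k) (G := G) N)
  rw [Module.finrank_zero_of_subsingleton, Nat.cast_zero] at horth
  exact (mul_eq_zero.1 horth).resolve_left (inv_ne_zero hcard)

theorem subsingleton_linearMap_span_singleton {A : Type*} [Ring A] [IsSemisimpleRing A] {c c' : A}
    (h : ∀ x, c * x * c' = 0) :
    Subsingleton ((Ideal.span {c} : Ideal A) →ₗ[A] (Ideal.span {c'} : Ideal A)) := by
  refine subsingleton_of_forall_eq 0 fun T => LinearMap.ext ?_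
  obtain ⟨T', hT'⟩ := IsSemisimpleModule.extension_property
    (Ideal.span {c}).subtype Subtype.val_injective T
  obtain ⟨v, hv⟩ := Ideal.mem_span_singleton'.1 (T' 1).2
  rintro ⟨x, hx⟩
  obtain ⟨u, rfl⟩ := Ideal.mem_span_singleton'.1 hx
  have hT : T ⟨u * c, hx⟩ = (u * c) • T' 1 := by
    rw [← hT', LinearMap.comp_apply, ← map_smul, smul_eq_mul, mul_one]
    rfl
  refine Subtype.ext ?_
  rw [hT, Submodule.coe_smul, smul_eq_mul, ← hv, mul_assoc, ← mul_assoc c, h, mul_zero]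
  rfl

theorem moduleChar_span_singleton_eq_add [Finite G] [NeZero (Nat.card G : k)] {c c' r : k[G]}
    (hle : (Ideal.span {c'} : Ideal k[G]) ≤ Ideal.span {c}) (hr : c' * r = 0)
    (hker : ∀ u, u * (c * r) = 0 → u * c ∈ (Ideal.span {c'} : Ideal k[G])) (g : G) :
    moduleChar (k := k) (Ideal.span {c} : Ideal k[G]) g =
      moduleChar (Ideal.span {c'} : Ideal k[G]) g +
        moduleChar (Ideal.span {c * r} : Ideal k[G]) g := by
  let ρ : k[G] →ₗ[k[G]] k[G] := LinearMap.toSpanSingleton k[G] k[G] r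
  have hρ : ∀ z ∈ Ideal.span {c}, ρ z ∈ (Ideal.span {c * r} : Ideal k[G]) := fun z hz => by
    obtain ⟨u, rfl⟩ := Ideal.mem_span_singleton'.1 hz
    exact Ideal.mem_span_singleton'.2 ⟨u, (mul_assoc u c r).symm⟩
  refine moduleChar_eq_add_of_exact (Submodule.inclusion_injective hle) (f := ρ.restrict hρ)
    (fun ⟨z, hz⟩ => ?_) (fun ⟨z, hz⟩ => ⟨fun h0 => ?_, ?_⟩) g
  · obtain ⟨u, rfl⟩ := Ideal.mem_span_singleton'.1 hz
    exact ⟨⟨u * c, Ideal.mul_mem_left _ _ (Ideal.mem_span_singleton_self c)⟩,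
      Subtype.ext (mul_assoc u c r)⟩
  · obtain ⟨u, rfl⟩ := Ideal.mem_span_singleton'.1 hz
    exact ⟨⟨_, hker u ((mul_assoc u c r).symm.trans (congrArg Subtype.val h0))⟩, rfl⟩
  · rintro ⟨⟨w, hw⟩, hwz⟩
    obtain ⟨u, rfl⟩ := Ideal.mem_span_singleton'.1 hw
    obtain rfl : u * c' = z := congrArg Subtype.val hwz
    refine Subtype.ext (?_ : u * c' * r = 0)
    rw [mul_assoc, hr, mul_zero]

/-- If `c * c = m • c`, then right multiplication by `m⁻¹ • c` projects `k[G]` onto `k[G] c`, so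
the character is the trace of `x ↦ m⁻¹ • g x c` on `k[G]`. -/
theorem moduleChar_span_singleton [Fintype G] {c : k[G]} {m : k} (hm : m ≠ 0)
    (hc : c * c = m • c) (g : G) :
    moduleChar (k := k) (Ideal.span {c} : Ideal k[G]) g =
      m⁻¹ * ∑ h, c.coeff (h⁻¹ * g⁻¹ * h) := by
  classical
  let I : Ideal k[G] := Ideal.span {c}
  let ι : I →ₗ[k] k[G] := I.subtype.restrictScalars k
  let π : k[G] →ₗ[k] I :=
    (LinearMap.mulRight k (m⁻¹ • c)).codRestrict (I.restrictScalars k) fun x => by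
      rw [LinearMap.mulRight_apply, mul_smul_comm, ← smul_mul_assoc]
      exact Ideal.mul_mem_left _ _ (Ideal.mem_span_singleton_self c)
  have hπι : π ∘ₗ ι = LinearMap.id := by
    ext1 ⟨x, hx⟩
    obtain ⟨u, rfl⟩ := Ideal.mem_span_singleton'.1 hx
    refine Subtype.ext (?_ : u * c * (m⁻¹ • c) = u * c)
    rw [mul_smul_comm, mul_assoc, hc, mul_smul_comm, inv_smul_smul₀ hm]
  have hconj : ι ∘ₗ ofModule' I g ∘ₗ π =
      LinearMap.mulLeft k (MonoidAlgebra.of k G g) ∘ₗ LinearMap.mulRight k (m⁻¹ • c) :=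
    LinearMap.ext fun x => congrArg Subtype.val (ofModule'_apply (k := k) g (π x))
  have htrace : moduleChar (k := k) I g = LinearMap.trace k _ (ι ∘ₗ ofModule' I g ∘ₗ π) := by
    rw [LinearMap.trace_comp_comm', LinearMap.comp_assoc, hπι, LinearMap.comp_id]
    rfl
  rw [htrace, hconj, LinearMap.trace_eq_matrix_trace k (MonoidAlgebra.basis G k), Matrix.trace,
    Finset.mul_sum]
  refine Finset.sum_congr rfl fun h _ => ?_
  rw [Matrix.diag_apply, LinearMap.toMatrix_apply, MonoidAlgebra.basis_apply]
  simp [MonoidAlgebra.basis, mul_assoc]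

end ModuleCharacter

/-! ### Symmetrizers and antisymmetrizers -/

section CharSum

open scoped Pointwise MonoidAlgebra

variable {G : Type*} [Group G] (k : Type*) [CommRing k]

/-- The sum of the elements of `U` in the group algebra, weighted by the character `ε`. -/
noncomputable def charSum (ε : G →* ℤˣ) (U : Finset G) : k[G] :=
  ∑ g ∈ U, ε g • MonoidAlgebra.of k G g

variable {k} {ε δ : G →* ℤˣ} {U V : Finset G} {t : G}

@[simp]
theorem charSum_singleton (ε : G →* ℤˣ) (t : G) :
    charSum k ε {t} = ε t • MonoidAlgebra.of k G t :=
  Finset.sum_singleton _ _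

theorem charSum_mul_charSum [DecidableEq G] (ε : G →* ℤˣ)
    (h : Set.InjOn (fun p : G × G => p.1 * p.2) (U ×ˢ V)) :
    charSum k ε U * charSum k ε V = charSum k ε (U * V) := by
  rw [← Finset.coe_product] at h
  rw [charSum, charSum, charSum, Finset.mul_def,
    Finset.sum_mul_sum, ← Finset.sum_product', Finset.sum_image h]
  refine Finset.sum_congr rfl fun p _ => ?_
  simp only [map_mul, smul_mul_assoc, mul_smul_comm, smul_smul, mul_comm]

theorem smul_of_mul_charSum [DecidableEq G] (ε : G →* ℤˣ) (t : G) (U : Finset G) :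
    (ε t • MonoidAlgebra.of k G t) * charSum k ε U = charSum k ε ({t} * U) := by
  rw [← charSum_singleton, charSum_mul_charSum]
  rintro ⟨a, b⟩ ⟨ha, -⟩ ⟨a', b'⟩ ⟨ha', -⟩ h
  simp_all

theorem charSum_mul_smul_of [DecidableEq G] (ε : G →* ℤˣ) (t : G) (U : Finset G) :
    charSum k ε U * (ε t • MonoidAlgebra.of k G t) = charSum k ε (U * {t}) := by
  rw [← charSum_singleton, charSum_mul_charSum]
  rintro ⟨a, b⟩ ⟨-, hb⟩ ⟨a', b'⟩ ⟨-, hb'⟩ h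
  simp_all

theorem singleton_mul_eq_self [DecidableEq G] (hU : U * U ⊆ U) (ht : t ∈ U) : {t} * U = U :=
  Finset.eq_of_subset_of_card_le
    ((Finset.mul_subset_mul_right (Finset.singleton_subset_iff.2 ht)).trans hU) (by simp)

theorem mul_singleton_eq_self [DecidableEq G] (hU : U * U ⊆ U) (ht : t ∈ U) : U * {t} = U :=
  Finset.eq_of_subset_of_card_le
    ((Finset.mul_subset_mul_left (Finset.singleton_subset_iff.2 ht)).trans hU) (by simp)

theorem of_mul_charSum [DecidableEq G] (ε : G →* ℤˣ) (hU : U * U ⊆ U) (ht : t ∈ U) :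
    MonoidAlgebra.of k G t * charSum k ε U = ε t • charSum k ε U := by
  conv_rhs => rw [← singleton_mul_eq_self hU ht, ← smul_of_mul_charSum, smul_mul_assoc, smul_smul,
    Int.units_mul_self, one_smul]

theorem charSum_mul_of [DecidableEq G] (ε : G →* ℤˣ) (hU : U * U ⊆ U) (ht : t ∈ U) :
    charSum k ε U * MonoidAlgebra.of k G t = ε t • charSum k ε U := by
  conv_rhs => rw [← mul_singleton_eq_self hU ht, ← charSum_mul_smul_of, mul_smul_comm, smul_smul,
    Int.units_mul_self, one_smul]

theorem charSum_mul_self [DecidableEq G] (ε : G →* ℤˣ) (hU : U * U ⊆ U) :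
    charSum k ε U * charSum k ε U = U.card • charSum k ε U := by
  nth_rewrite 1 [charSum]
  rw [Finset.sum_mul, ← Finset.sum_const]
  refine Finset.sum_congr rfl fun t ht => ?_
  rw [smul_mul_assoc, of_mul_charSum ε hU ht, smul_smul, Int.units_mul_self, one_smul]

theorem of_mul_charSum_of_conj [DecidableEq G] (ε : G →* ℤˣ) (h : {t} * U = V * {t}) :
    MonoidAlgebra.of k G t * charSum k ε U = charSum k ε V * MonoidAlgebra.of k G t := by
  have h' := smul_of_mul_charSum (k := k) ε t U
  rw [h, ← charSum_mul_smul_of, smul_mul_assoc, mul_smul_comm] at h'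
  exact MulAction.injective (ε t) h'

theorem commute_charSum (ε δ : G →* ℤˣ) (h : ∀ p ∈ U, ∀ q ∈ V, Commute p q) :
    Commute (charSum k ε U) (charSum k δ V) :=
  Commute.sum_left _ _ _ fun p hp => Commute.sum_right _ _ _ fun q hq =>
    (((h p hp q hq).map (MonoidAlgebra.of k G)).smul_right _).smul_left _

variable [IsAddTorsionFree k]

theorem charSum_mul_of_mul_charSum_eq_zero [DecidableEq G] (hU : U * U ⊆ U) (hV : V * V ⊆ V)
    {g : G} (ht : t ∈ U) (htg : g⁻¹ * t * g ∈ V) (h : ε t ≠ δ (g⁻¹ * t * g)) :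
    charSum k ε U * MonoidAlgebra.of k G g * charSum k δ V = 0 := by
  have hneg : ε t * δ (g⁻¹ * t * g) = -1 := by
    obtain h₁ | h₁ := Int.units_eq_one_or (ε t) <;>
      obtain h₂ | h₂ := Int.units_eq_one_or (δ (g⁻¹ * t * g)) <;> simp_all
  suffices hself : charSum k ε U * MonoidAlgebra.of k G g * charSum k δ V =
      -(charSum k ε U * MonoidAlgebra.of k G g * charSum k δ V) from
    MonoidAlgebra.ext (Finsupp.ext fun x => self_eq_neg.1 (congrArg (fun z => z.coeff x) hself))
  calc charSum k ε U * MonoidAlgebra.of k G g * charSum k δ V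
      = ε t • (charSum k ε U * MonoidAlgebra.of k G t) * MonoidAlgebra.of k G g *
          charSum k δ V := by
        rw [charSum_mul_of ε hU ht, smul_smul, Int.units_mul_self, one_smul]
    _ = ε t • (charSum k ε U * MonoidAlgebra.of k G g *
          (MonoidAlgebra.of k G (g⁻¹ * t * g) * charSum k δ V)) := by
        simp only [smul_mul_assoc, mul_assoc, ← map_mul]
        simp only [← mul_assoc, ← map_mul, mul_inv_cancel, one_mul]
    _ = -(charSum k ε U * MonoidAlgebra.of k G g * charSum k δ V) := by
        rw [of_mul_charSum δ hV htg, mul_smul_comm, smul_smul, hneg, Units.neg_smul, one_smul]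

theorem charSum_mul_mul_charSum_eq_zero [DecidableEq G] (hU : U * U ⊆ U) (hV : V * V ⊆ V)
    (h : ∀ g, ∃ t ∈ U, g⁻¹ * t * g ∈ V ∧ ε t ≠ δ (g⁻¹ * t * g)) (x : k[G]) :
    charSum k ε U * x * charSum k δ V = 0 := by
  induction x using MonoidAlgebra.induction_on with
  | of g =>
    obtain ⟨t, ht, htg, hne⟩ := h g
    exact charSum_mul_of_mul_charSum_eq_zero hU hV ht htg hne
  | add x y hx hy => rw [mul_add, add_mul, hx, hy, add_zero]
  | smul c x hx => rw [mul_smul_comm, smul_mul_assoc, hx, smul_zero]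

end CharSum

section PermsOn

open Equiv
open scoped Pointwise

variable {α : Type*} [DecidableEq α] {A : Finset α} {σ : Perm α}

theorem swap_right_injective (s : α) : Function.Injective (swap · s) := fun y y' h => by
  simpa using congrArg (· s) h

theorem smul_eq_self_of_fixed (h : ∀ i ∈ A, σ i = i) : σ • A = A :=
  (Finset.image_congr (g := id) h).trans Finset.image_id

theorem swap_smul_insert {i j : α} (hi : i ∉ A) (hj : j ∉ A) :
    swap i j • insert i A = insert j A := by
  rw [Finset.smul_finset_insert, Perm.smul_def, swap_apply_left, smul_eq_self_of_fixed fun l hl =>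
    swap_apply_of_ne_of_ne (ne_of_mem_of_not_mem hl hi) (ne_of_mem_of_not_mem hl hj)]

variable [Fintype α]

/-- The symmetric group of `A`, as the set of permutations that fix every point outside `A`. -/
def permsOn (A : Finset α) : Finset (Perm α) := {σ | ∀ i, i ∉ A → σ i = i}

theorem mem_permsOn : σ ∈ permsOn A ↔ ∀ i, i ∉ A → σ i = i := by
  simp [permsOn]

theorem permsOn_mul_permsOn_subset (A : Finset α) : permsOn A * permsOn A ⊆ permsOn A :=
  Finset.mul_subset_iff.2 fun σ hσ τ hτ => mem_permsOn.2 fun i hi => by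
    rw [Perm.mul_apply, mem_permsOn.1 hτ i hi, mem_permsOn.1 hσ i hi]

theorem inv_mem_permsOn (hσ : σ ∈ permsOn A) : σ⁻¹ ∈ permsOn A :=
  mem_permsOn.2 fun i hi => by rw [Perm.inv_eq_iff_eq, mem_permsOn.1 hσ i hi]

theorem swap_mem_permsOn {i j : α} (hi : i ∈ A) (hj : j ∈ A) : swap i j ∈ permsOn A :=
  mem_permsOn.2 fun _ hk => swap_apply_of_ne_of_ne (ne_of_mem_of_not_mem hi hk).symm
    (ne_of_mem_of_not_mem hj hk).symm

theorem apply_mem_iff_of_mem_permsOn (hσ : σ ∈ permsOn A) {i : α} : σ i ∈ A ↔ i ∈ A := by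
  by_cases hi : i ∈ A
  · refine iff_of_true (by_contra fun h => h ?_) hi
    rwa [σ.injective (mem_permsOn.1 hσ _ h)]
  · rw [mem_permsOn.1 hσ i hi]

theorem permsOn_mono {B : Finset α} (h : A ⊆ B) : permsOn A ⊆ permsOn B := fun _ hσ =>
  mem_permsOn.2 fun i hi => mem_permsOn.1 hσ i fun h' => hi (h h')

theorem card_permsOn (A : Finset α) : (permsOn A).card = A.card ! := by
  have h := Fintype.card_congr (Perm.subtypeEquivSubtypePerm (fun i => i ∈ A))
  rw [Fintype.card_perm, Fintype.card_coe] at h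
  rw [h, Fintype.card_subtype, permsOn]

theorem singleton_mul_permsOn (σ : Perm α) (A : Finset α) :
    {σ} * permsOn A = permsOn (σ • A) * {σ} := by
  have hconj : ∀ ρ, σ * ρ * σ⁻¹ ∈ permsOn (σ • A) ↔ ρ ∈ permsOn A := fun ρ => by
    rw [mem_permsOn, mem_permsOn, ← σ.forall_congr_right]
    simp only [← Perm.smul_def, Finset.smul_mem_smul_finset_iff, mul_smul, inv_smul_smul,
      smul_left_cancel_iff]
  refine subset_antisymm (Finset.mul_subset_iff.2 fun τ hτ ρ hρ => ?_)
    (Finset.mul_subset_iff.2 fun ρ hρ τ hτ => ?_) <;> rw [Finset.mem_singleton.1 hτ]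
  · exact Finset.mem_mul.2 ⟨_, (hconj ρ).2 hρ, σ, Finset.mem_singleton_self σ,
      inv_mul_cancel_right _ _⟩
  · exact Finset.mem_mul.2 ⟨σ, Finset.mem_singleton_self σ, σ⁻¹ * ρ * σ,
      (hconj _).1 (by simpa [mul_assoc] using hρ), by simp [mul_assoc]⟩

theorem permsOn_mul_image_swap {s : α} (A : Finset α) :
    permsOn A * (insert s A).image (swap · s) = permsOn (insert s A) := by
  have hsub := permsOn_mono (Finset.subset_insert s A)
  refine subset_antisymm ?_ fun σ hσ => ?_
  · refine (Finset.mul_subset_mul hsub ?_).trans (permsOn_mul_permsOn_subset _)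
    exact Finset.image_subset_iff.2 fun y hy => swap_mem_permsOn hy (Finset.mem_insert_self s A)
  · have hy : σ⁻¹ s ∈ insert s A :=
      (apply_mem_iff_of_mem_permsOn (inv_mem_permsOn hσ)).2 (Finset.mem_insert_self s A)
    refine Finset.mem_mul.2 ⟨σ * swap (σ⁻¹ s) s, mem_permsOn.2 fun i hi => ?_, swap (σ⁻¹ s) s,
      Finset.mem_image_of_mem _ hy, by rw [mul_assoc, swap_mul_self, mul_one]⟩
    by_cases his : i = s
    · simp [his]
    · exact mem_permsOn.1 (permsOn_mul_permsOn_subset _ (Finset.mul_mem_mul hσ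
        (swap_mem_permsOn hy (Finset.mem_insert_self s A)))) i (by simp [his, hi])

theorem inv_permsOn (A : Finset α) : (permsOn A)⁻¹ = permsOn A := by
  ext σ
  exact ⟨fun h => by simpa using inv_mem_permsOn (Finset.mem_inv'.1 h),
    fun h => Finset.mem_inv'.2 (inv_mem_permsOn h)⟩

theorem image_swap_mul_permsOn {s : α} (A : Finset α) :
    (insert s A).image (swap · s) * permsOn A = permsOn (insert s A) := by
  rw [← inv_permsOn (insert s A), ← permsOn_mul_image_swap, mul_inv_rev, inv_permsOn]
  congr 1
  rw [← Finset.image_inv_eq_inv, Finset.image_image]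
  simp [Function.comp_def]

end PermsOn

section SymAlt

open Equiv
open scoped MonoidAlgebra Pointwise

variable {α : Type*} [DecidableEq α] {A S : Finset α} {k : Type*}

section CommRing

variable [CommRing k]

theorem sum_swap_insert {s : α} (hs : s ∉ A) :
    ∑ y ∈ insert s A, (1 : Perm α →* ℤˣ) (swap y s) • MonoidAlgebra.of k _ (swap y s) =
      1 + ∑ y ∈ A, MonoidAlgebra.of k _ (swap y s) := by
  rw [Finset.sum_insert hs]
  simp [MonoidAlgebra.one_def, Perm.one_def]

variable [Fintype α]

theorem sum_sign_smul_swap_insert {x : α} (hx : x ∉ S) :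
    ∑ y ∈ insert x S, Perm.sign (swap y x) • MonoidAlgebra.of k _ (swap y x) =
      1 - ∑ y ∈ S, MonoidAlgebra.of k _ (swap y x) := by
  rw [Finset.sum_insert hx, sub_eq_add_neg, ← Finset.sum_neg_distrib]
  congr 1
  · simp [MonoidAlgebra.one_def, Perm.one_def]
  · refine Finset.sum_congr rfl fun y hy => ?_
    rw [Perm.sign_swap (ne_of_mem_of_not_mem hy hx), Units.neg_smul, one_smul]

variable (k)

theorem charSum_image_swap (ε : Perm α →* ℤˣ) (s : α) (A : Finset α) :
    charSum k ε (A.image (swap · s)) =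
      ∑ y ∈ A, ε (swap y s) • MonoidAlgebra.of k _ (swap y s) :=
  Finset.sum_image (swap_right_injective s).injOn

theorem charSum_insert (ε : Perm α →* ℤˣ) {s : α} (hs : s ∉ A) :
    charSum k ε (permsOn (insert s A)) = charSum k ε (permsOn A) *
      ∑ y ∈ insert s A, ε (swap y s) • MonoidAlgebra.of k _ (swap y s) := by
  rw [← permsOn_mul_image_swap, ← charSum_mul_charSum, charSum_image_swap]
  rintro ⟨p, _⟩ ⟨hp, hy⟩ ⟨q, _⟩ ⟨hq, hz⟩ h
  obtain ⟨y, -, rfl⟩ := Finset.mem_image.1 hy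
  obtain ⟨z, -, rfl⟩ := Finset.mem_image.1 hz
  have hps : p.symm s = s := mem_permsOn.1 (inv_mem_permsOn hp) s hs
  have hqs : q.symm s = s := mem_permsOn.1 (inv_mem_permsOn hq) s hs
  have hyz : y = z := by simpa [hps, hqs] using congrArg (·⁻¹ s) h
  subst hyz
  simpa using h

theorem charSum_insert' (ε : Perm α →* ℤˣ) {s : α} (hs : s ∉ A) :
    charSum k ε (permsOn (insert s A)) =
      (∑ y ∈ insert s A, ε (swap y s) • MonoidAlgebra.of k _ (swap y s)) *
        charSum k ε (permsOn A) := by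
  rw [← image_swap_mul_permsOn, ← charSum_mul_charSum, charSum_image_swap]
  rintro ⟨_, p⟩ ⟨hy, hp⟩ ⟨_, q⟩ ⟨hz, hq⟩ h
  obtain ⟨y, -, rfl⟩ := Finset.mem_image.1 hy
  obtain ⟨z, -, rfl⟩ := Finset.mem_image.1 hz
  have hps := mem_permsOn.1 hp s hs
  have hqs := mem_permsOn.1 hq s hs
  have hyz : y = z := by simpa [hps, hqs] using congrArg (· s) h
  subst hyz
  simpa using h

/-- The symmetrizer of `A`. -/
noncomputable abbrev symSum (A : Finset α) : k[Perm α] := charSum k 1 (permsOn A)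

/-- The antisymmetrizer of `S`. -/
noncomputable abbrev altSum (S : Finset α) : k[Perm α] := charSum k Perm.sign (permsOn S)

variable {k}

theorem symSum_insert {s : α} (hs : s ∉ A) :
    symSum k (insert s A) = symSum k A * (1 + ∑ y ∈ A, MonoidAlgebra.of k _ (swap y s)) := by
  rw [symSum, charSum_insert k 1 hs, sum_swap_insert hs]

theorem symSum_insert' {s : α} (hs : s ∉ A) :
    symSum k (insert s A) = (1 + ∑ y ∈ A, MonoidAlgebra.of k _ (swap y s)) * symSum k A := by
  rw [symSum, charSum_insert' k 1 hs, sum_swap_insert hs]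

theorem altSum_insert {x : α} (hx : x ∉ S) :
    altSum k (insert x S) = altSum k S * (1 - ∑ y ∈ S, MonoidAlgebra.of k _ (swap y x)) := by
  rw [altSum, charSum_insert k _ hx, sum_sign_smul_swap_insert hx]

theorem altSum_insert' {x : α} (hx : x ∉ S) :
    altSum k (insert x S) = (1 - ∑ y ∈ S, MonoidAlgebra.of k _ (swap y x)) * altSum k S := by
  rw [altSum, charSum_insert' k _ hx, sum_sign_smul_swap_insert hx]

theorem symSum_mul_of {p : Perm α} (hp : p ∈ permsOn A) :
    symSum k A * MonoidAlgebra.of k _ p = symSum k A := by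
  rw [symSum, charSum_mul_of 1 (permsOn_mul_permsOn_subset A) hp, MonoidHom.one_apply, one_smul]

theorem of_mul_charSum_permsOn (ε : Perm α →* ℤˣ) (σ : Perm α) (A : Finset α) :
    MonoidAlgebra.of k _ σ * charSum k ε (permsOn A) =
      charSum k ε (permsOn (σ • A)) * MonoidAlgebra.of k _ σ :=
  of_mul_charSum_of_conj ε (singleton_mul_permsOn σ A)

theorem commute_symSum_altSum (h : Disjoint A S) : Commute (symSum k A) (altSum k S) :=
  commute_charSum _ _ fun _ hp _ hq => Perm.Disjoint.commute fun i => (em (i ∈ A)).symm.imp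
    (mem_permsOn.1 hp i) fun hi => mem_permsOn.1 hq i (Finset.disjoint_left.1 h hi)

theorem symSum_insert_mul_altSum (h : Disjoint A S) {s t : α} (hs : s ∈ S) (ht : t ∈ S) :
    symSum k (insert t A) * altSum k S =
      Perm.sign (swap s t) • MonoidAlgebra.of k _ (swap s t) *
        (symSum k (insert s A) * altSum k S) := by
  rw [← mul_assoc, smul_mul_assoc, of_mul_charSum_permsOn,
    swap_smul_insert (Finset.disjoint_right.1 h hs) (Finset.disjoint_right.1 h ht), smul_mul_assoc,
    mul_assoc, of_mul_charSum _ (permsOn_mul_permsOn_subset S) (swap_mem_permsOn hs ht),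
    mul_smul_comm, smul_smul, Int.units_mul_self, one_smul]

theorem symSum_mul_altSum_insert (h : Disjoint A S) {x y : α} (hx : x ∈ A) (hy : y ∈ A) :
    symSum k A * altSum k (insert y S) =
      symSum k A * altSum k (insert x S) * MonoidAlgebra.of k _ (swap x y) := by
  have hconj := of_mul_charSum_permsOn (k := k) Perm.sign (swap x y) (insert x S)
  rw [swap_smul_insert (Finset.disjoint_left.1 h hx) (Finset.disjoint_left.1 h hy)] at hconj
  calc symSum k A * altSum k (insert y S)
      = symSum k A * (altSum k (insert y S) * MonoidAlgebra.of k _ (swap x y)) *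
          MonoidAlgebra.of k _ (swap x y) := by
        rw [mul_assoc, mul_assoc, ← map_mul, swap_mul_self, map_one, mul_one]
    _ = symSum k A * altSum k (insert x S) * MonoidAlgebra.of k _ (swap x y) := by
        rw [← hconj, ← mul_assoc, symSum_mul_of (swap_mem_permsOn hx hy)]

/-- The two one-box enlargements of `A` and `S` cancel except for the identity terms. -/
theorem sum_symSum_insert_add_sum_altSum_insert (h : Disjoint A S) :
    ∑ s ∈ S, symSum k (insert s A) * altSum k S + ∑ x ∈ A, symSum k A * altSum k (insert x S) =
      (A.card + S.card) • (symSum k A * altSum k S) := by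
  have hsym : ∀ s ∈ S, symSum k (insert s A) * altSum k S = symSum k A * altSum k S +
      ∑ x ∈ A, symSum k A * MonoidAlgebra.of k _ (swap x s) * altSum k S := fun s hs => by
    rw [symSum_insert (Finset.disjoint_right.1 h hs), mul_add, mul_one, add_mul, Finset.mul_sum,
      Finset.sum_mul]
  have halt : ∀ x ∈ A, symSum k A * altSum k (insert x S) = symSum k A * altSum k S -
      ∑ s ∈ S, symSum k A * MonoidAlgebra.of k _ (swap x s) * altSum k S := fun x hx => by
    simp only [swap_comm x, altSum_insert' (Finset.disjoint_left.1 h hx), sub_mul, one_mul, mul_sub,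
      Finset.sum_mul, Finset.mul_sum, mul_assoc]
  rw [Finset.sum_congr rfl hsym, Finset.sum_congr rfl halt, Finset.sum_add_distrib,
    Finset.sum_sub_distrib, Finset.sum_comm, Finset.sum_const, Finset.sum_const, add_smul]
  abel

theorem span_symSum_insert_mul_altSum_le {s : α} (hs : s ∉ A) :
    Ideal.span {symSum k (insert s A) * altSum k S} ≤ Ideal.span {symSum k A * altSum k S} := by
  rw [Ideal.span_singleton_le_iff_mem, symSum_insert' hs, mul_assoc]
  exact Ideal.mul_mem_left _ _ (Ideal.mem_span_singleton_self _)

end CommRing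

variable [Fintype α] [Field k] [CharZero k]

theorem symSum_mul_altSum_eq_zero {i j : α} (hij : i ≠ j) (hiA : i ∈ A) (hjA : j ∈ A)
    (hiS : i ∈ S) (hjS : j ∈ S) : symSum k A * altSum k S = 0 := by
  have h := charSum_mul_of_mul_charSum_eq_zero (k := k) (ε := 1) (δ := Perm.sign) (g := 1)
    (permsOn_mul_permsOn_subset A) (permsOn_mul_permsOn_subset S) (swap_mem_permsOn hiA hjA)
    (by simpa using swap_mem_permsOn hiS hjS) (by simp [Perm.sign_swap hij])
  rwa [map_one, mul_one] at h

theorem mem_span_symSum_insert_of_mul_eq_zero (h : Disjoint A S) {x s : α} (hx : x ∈ A)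
    (hs : s ∈ S) {u : k[Perm α]} (hu : u * (symSum k A * altSum k (insert x S)) = 0) :
    u * (symSum k A * altSum k S) ∈ Ideal.span {symSum k (insert s A) * altSum k S} := by
  have hcard : ((A.card + S.card : ℕ) : k) ≠ 0 :=
    Nat.cast_ne_zero.2 (Nat.add_pos_left (Finset.card_pos.2 ⟨x, hx⟩) _).ne'
  have hzero : u * ∑ y ∈ A, symSum k A * altSum k (insert y S) = 0 := by
    rw [Finset.mul_sum]
    refine Finset.sum_eq_zero fun y hy => ?_
    rw [symSum_mul_altSum_insert h hx hy, ← mul_assoc, hu, zero_mul]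
  have hsum : u * (symSum k A * altSum k S) = ((A.card + S.card : ℕ) : k)⁻¹ •
      ∑ t ∈ S, u * (symSum k (insert t A) * altSum k S) := by
    rw [eq_inv_smul_iff₀ hcard, Nat.cast_smul_eq_nsmul, ← mul_smul_comm,
      ← sum_symSum_insert_add_sum_altSum_insert h, mul_add, hzero, add_zero, Finset.mul_sum]
  rw [hsum]
  refine Submodule.smul_of_tower_mem _ _ (Submodule.sum_mem _ fun t ht => Ideal.mul_mem_left _ _ ?_)
  rw [symSum_insert_mul_altSum h hs ht]
  exact Ideal.mul_mem_left _ _ (Ideal.mem_span_singleton_self _)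

theorem moduleChar_symSum_mul_altSum (h : Disjoint A S) {x s : α} (hx : x ∈ A) (hs : s ∈ S)
    (g : Perm α) :
    moduleChar (k := k) (Ideal.span {symSum k A * altSum k S}) g =
      moduleChar (Ideal.span {symSum k (insert s A) * altSum k S}) g +
        moduleChar (Ideal.span {symSum k A * altSum k (insert x S)}) g := by
  have hxS := Finset.disjoint_left.1 h hx
  rw [altSum_insert hxS, ← mul_assoc]
  refine moduleChar_span_singleton_eq_add
    (span_symSum_insert_mul_altSum_le (Finset.disjoint_right.1 h hs)) ?_ (fun u hu => ?_) g
  · rw [mul_assoc, ← altSum_insert hxS]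
    exact symSum_mul_altSum_eq_zero (ne_of_mem_of_not_mem hs hxS).symm (Finset.mem_insert_of_mem hx)
      (Finset.mem_insert_self _ _) (Finset.mem_insert_self _ _) (Finset.mem_insert_of_mem hs)
  · rw [mul_assoc, ← altSum_insert hxS] at hu
    exact mem_span_symSum_insert_of_mul_eq_zero h hx hs hu

end SymAlt

theorem card_smul_sum_smul_eq {G X M : Type*} [Group G] [MulAction G X]
    [MulAction.IsPretransitive G X] [Fintype G] [Fintype X] [AddCommMonoid M] (f : X → M) (x : X) :
    Fintype.card X • ∑ g : G, f (g • x) = Fintype.card G • ∑ y, f y := by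
  have hconst : ∀ y, ∑ g : G, f (g • y) = ∑ g : G, f (g • x) := fun y => by
    obtain ⟨h, rfl⟩ := MulAction.exists_smul_eq G x y
    simp only [smul_smul]
    exact Equiv.sum_comp (Equiv.mulRight h) fun g => f (g • x)
  calc Fintype.card X • ∑ g : G, f (g • x) = ∑ y, ∑ g : G, f (g • y) := by
        simp only [hconst, Finset.sum_const, Finset.card_univ]
    _ = ∑ g : G, ∑ y, f (g • y) := Finset.sum_comm
    _ = Fintype.card G • ∑ y, f y := by
        simp only [← MulAction.toPerm_apply, Equiv.sum_comp, Finset.sum_const, Finset.card_univ]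

section Exterior

open Equiv
open scoped MonoidAlgebra Pointwise

variable {α : Type*} [Fintype α] [DecidableEq α] {S : Finset α}

/-- The sign of the restriction of `g` to `S`, or `0` if `S` is not invariant. -/
def signOn (g : Perm α) (S : Finset α) : ℤ :=
  if h : ∀ x, g x ∈ S ↔ x ∈ S then Perm.sign (g.subtypePerm h) else 0

theorem mul_inv_mem_permsOn_compl_iff {g q : Perm α} (hq : q ∈ permsOn S) :
    g * q⁻¹ ∈ permsOn Sᶜ ↔ ∀ x ∈ S, g x = q x := by
  rw [mem_permsOn, ← q.forall_congr_right]
  simp [apply_mem_iff_of_mem_permsOn hq]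

theorem mul_inv_mem_permsOn_compl_iff_eq_ofSubtype {g q : Perm α} (hq : q ∈ permsOn S)
    (h : ∀ x, g x ∈ S ↔ x ∈ S) :
    g * q⁻¹ ∈ permsOn Sᶜ ↔ q = Perm.ofSubtype (g.subtypePerm h) := by
  rw [mul_inv_mem_permsOn_compl_iff hq, Perm.ext_iff]
  refine forall_congr' fun x => ?_
  by_cases hx : x ∈ S
  · simp [hx, Perm.ofSubtype_apply_of_mem, eq_comm]
  · simp [hx, Perm.ofSubtype_apply_of_not_mem, mem_permsOn.1 hq x hx]

theorem apply_mem_iff_of_mul_inv_mem_permsOn_compl {g q : Perm α} (hq : q ∈ permsOn S)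
    (hgq : g * q⁻¹ ∈ permsOn Sᶜ) (x : α) : g x ∈ S ↔ x ∈ S := by
  rw [← inv_mul_cancel_right g q, Perm.mul_apply, ← not_iff_not, ← Finset.mem_compl,
    ← Finset.mem_compl, apply_mem_iff_of_mem_permsOn hgq, Finset.mem_compl, Finset.mem_compl,
    apply_mem_iff_of_mem_permsOn hq]

section CommRing

variable {k : Type*} [CommRing k]

theorem coeff_symSum_mul_altSum_eq_sum (g : Perm α) (A S : Finset α) :
    (symSum k A * altSum k S).coeff g =
      ∑ q ∈ permsOn S, if g * q⁻¹ ∈ permsOn A then ((Perm.sign q : ℤ) : k) else 0 := by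
  have hprod : symSum k A * altSum k S = ∑ q ∈ permsOn S, ∑ p ∈ permsOn A,
      Perm.sign q • MonoidAlgebra.of k _ (p * q) := by
    rw [symSum, altSum, charSum, charSum, Finset.sum_mul_sum, Finset.sum_comm]
    simp only [MonoidHom.one_apply, one_smul, mul_smul_comm, map_mul]
  rw [hprod]
  simp [Units.smul_def, Finsupp.single_apply, ← eq_mul_inv_iff_mul_eq]

theorem coeff_symSum_compl_mul_altSum (g : Perm α) (S : Finset α) :
    (symSum k Sᶜ * altSum k S).coeff g = signOn g S := by
  rw [coeff_symSum_mul_altSum_eq_sum, signOn]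
  split_ifs with h
  · rw [Finset.sum_congr rfl fun q hq => if_congr
      (mul_inv_mem_permsOn_compl_iff_eq_ofSubtype hq h) rfl rfl, Finset.sum_ite_eq',
      if_pos (mem_permsOn.2 fun i hi => Perm.ofSubtype_apply_of_not_mem _ hi), Perm.sign_ofSubtype]
  · rw [Int.cast_zero]
    exact Finset.sum_eq_zero fun q hq => if_neg fun hgq =>
      h (apply_mem_iff_of_mul_inv_mem_permsOn_compl hq hgq)

theorem coeff_symSum_compl_mul_altSum_conj (S : Finset α) (g h : Perm α) :
    (symSum k Sᶜ * altSum k S).coeff (h⁻¹ * g * h) = signOn g (h • S) := by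
  have hcompl : h • Sᶜ = (h • S)ᶜ := by ext; simp [← Finset.inv_smul_mem_iff]
  have hmul : MonoidAlgebra.of k _ h * (symSum k Sᶜ * altSum k S) =
      symSum k (h • S)ᶜ * altSum k (h • S) * MonoidAlgebra.of k _ h := by
    rw [← mul_assoc, of_mul_charSum_permsOn, mul_assoc, of_mul_charSum_permsOn, ← mul_assoc, hcompl]
  have hcoeff := congrArg (fun z => z.coeff (g * h)) hmul
  rw [← coeff_symSum_compl_mul_altSum (k := k) g]
  simpa [mul_assoc (h⁻¹)] using hcoeff

theorem symSum_mul_altSum_mul_self {A : Finset α} (h : Disjoint A S) :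
    (symSum k A * altSum k S) * (symSum k A * altSum k S) =
      ((A.card ! * S.card ! : ℕ) : k) • (symSum k A * altSum k S) := by
  rw [(commute_symSum_altSum h).symm.mul_mul_mul_comm,
    charSum_mul_self _ (permsOn_mul_permsOn_subset A),
    charSum_mul_self _ (permsOn_mul_permsOn_subset S), card_permsOn, card_permsOn,
    smul_mul_smul_comm, Nat.cast_smul_eq_nsmul]

end CommRing

theorem moduleChar_symSum_compl_mul_altSum {k : Type*} [Field k] [CharZero k] (g : Perm α)
    (S : Finset α) :
    moduleChar (k := k) (Ideal.span {symSum k Sᶜ * altSum k S}) g =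
      ∑ S' ∈ Finset.powersetCard S.card Finset.univ, (signOn g⁻¹ S' : k) := by
  have hm : ((Sᶜ.card ! * S.card ! : ℕ) : k) ≠ 0 :=
    Nat.cast_ne_zero.2 (mul_ne_zero (Nat.factorial_ne_zero _) (Nat.factorial_ne_zero _))
  have hchoose : ((Fintype.card α).choose S.card : k) ≠ 0 :=
    Nat.cast_ne_zero.2 (Nat.choose_pos (Finset.card_le_univ S)).ne'
  have hfact : (Fintype.card α)! = (Fintype.card α).choose S.card * (Sᶜ.card ! * S.card !) := by
    rw [Finset.card_compl, mul_comm _ S.card !, ← mul_assoc,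
      Nat.choose_mul_factorial_mul_factorial (Finset.card_le_univ S)]
  have := Set.powersetCard.isPretransitive (α := α) (n := S.card)
  have hsum := card_smul_sum_smul_eq (G := Perm α)
    (fun T : Set.powersetCard α S.card => (signOn g⁻¹ (T : Finset α) : k)) ⟨S, rfl⟩
  rw [← Nat.card_eq_fintype_card, Set.powersetCard.card, Nat.card_eq_fintype_card,
    Fintype.card_perm, hfact, ← Finset.sum_subtype (p := (· ∈ Set.powersetCard α S.card))
      (Finset.powersetCard S.card Finset.univ) (by simp) (fun T => (signOn g⁻¹ T : k)),
    mul_smul, ← Nat.cast_smul_eq_nsmul k, ← Nat.cast_smul_eq_nsmul k, smul_right_inj hchoose,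
    ← Nat.cast_smul_eq_nsmul k] at hsum
  rw [moduleChar_span_singleton hm (symSum_mul_altSum_mul_self disjoint_compl_left),
    inv_mul_eq_iff_eq_mul₀ hm, ← smul_eq_mul _ (Finset.sum _ _), ← hsum]
  exact Finset.sum_congr rfl fun h _ => coeff_symSum_compl_mul_altSum_conj S g⁻¹ h

end Exterior

section Orbits

open Equiv
open scoped MonoidAlgebra

variable {α : Type*}

/-- The set of orbits of a permutation `g`, where fixed points count as orbits of size one. -/
abbrev PermOrbit (g : Perm α) : Type _ := Quotient (Perm.SameCycle.setoid g)

/-- The orbit of a point. -/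
abbrev toPermOrbit (g : Perm α) (x : α) : PermOrbit g := Quotient.mk (Perm.SameCycle.setoid g) x

theorem toPermOrbit_eq_iff {g : Perm α} {x y : α} :
    toPermOrbit g x = toPermOrbit g y ↔ g.SameCycle x y :=
  Quotient.eq (r := Perm.SameCycle.setoid g)

variable [Fintype α] [DecidableEq α]

instance decidableRelSetoid (g : Perm α) : DecidableRel (Perm.SameCycle.setoid g).r :=
  inferInstanceAs (DecidableRel g.SameCycle)

/-- The union of a set of orbits. -/
def orbitUnion (g : Perm α) (T : Finset (PermOrbit g)) : Finset α :=
  {x | toPermOrbit g x ∈ T}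

variable {g : Perm α}

theorem mem_orbitUnion {T : Finset (PermOrbit g)} {x : α} :
    x ∈ orbitUnion g T ↔ toPermOrbit g x ∈ T := by simp [orbitUnion]

theorem mem_orbitUnion_singleton {ω : PermOrbit g} {x : α} :
    x ∈ orbitUnion g {ω} ↔ g.SameCycle ω.out x := by
  rw [mem_orbitUnion, Finset.mem_singleton, ← toPermOrbit_eq_iff,
    show toPermOrbit g ω.out = ω from Quotient.out_eq ω, eq_comm]

theorem apply_mem_orbitUnion (g : Perm α) (T : Finset (PermOrbit g)) (x : α) :
    g x ∈ orbitUnion g T ↔ x ∈ orbitUnion g T := by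
  rw [mem_orbitUnion, mem_orbitUnion,
    toPermOrbit_eq_iff.2 (Perm.sameCycle_apply_left.2 (.refl g x))]

theorem orbitUnion_injective (g : Perm α) : Function.Injective (orbitUnion g) := fun T T' h => by
  ext ω
  induction ω using Quotient.inductionOn with
  | h x => rw [← mem_orbitUnion, h, mem_orbitUnion]

theorem orbitUnion_image_toPermOrbit {S : Finset α} (hS : ∀ x, g x ∈ S ↔ x ∈ S) :
    orbitUnion g (S.image (toPermOrbit g)) = S := by
  ext x
  rw [mem_orbitUnion, Finset.mem_image]
  refine ⟨?_, fun hx => ⟨x, hx, rfl⟩⟩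
  rintro ⟨y, hy, hyx⟩
  obtain ⟨k, rfl⟩ := toPermOrbit_eq_iff.1 hyx
  simpa [Perm.subtypePerm_zpow] using ((g.subtypePerm hS ^ k) ⟨y, hy⟩).2

theorem card_orbitUnion (g : Perm α) (T : Finset (PermOrbit g)) :
    (orbitUnion g T).card = ∑ ω ∈ T, (orbitUnion g {ω}).card := by
  rw [← Finset.card_biUnion]
  · congr 1
    ext x
    simp [mem_orbitUnion]
  · intro ω _ ω' _ hne
    exact Finset.disjoint_left.2 fun x hx hx' => hne <| by
      rw [← Finset.mem_singleton.1 (mem_orbitUnion.1 hx),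
        Finset.mem_singleton.1 (mem_orbitUnion.1 hx')]

theorem card_orbitUnion_singleton_of_fixed {ω : PermOrbit g} (hω : g ω.out = ω.out) :
    (orbitUnion g {ω}).card = 1 := by
  refine Finset.card_eq_one.2 ⟨ω.out, ?_⟩
  ext x
  rw [mem_orbitUnion_singleton, Finset.mem_singleton]
  exact ⟨fun h => (h.eq_of_left hω).symm, fun h => h ▸ .refl g _⟩

theorem card_permOrbit_subtypePerm (g : Perm α) (T : Finset (PermOrbit g)) :
    Fintype.card (PermOrbit (g.subtypePerm (apply_mem_orbitUnion g T))) = T.card := by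
  rw [← Finset.card_univ]
  refine Finset.card_bij (fun ω _ => toPermOrbit g ω.out) (fun ω _ => mem_orbitUnion.1 ω.out.2)
    (fun ω _ ω' _ h => ?_) (fun ω hω => ?_)
  · rw [← Quotient.out_eq ω, ← Quotient.out_eq ω']
    exact toPermOrbit_eq_iff.2 (Perm.sameCycle_subtypePerm.2 (toPermOrbit_eq_iff.1 h))
  · induction ω using Quotient.inductionOn with
    | h x =>
      refine ⟨toPermOrbit _ ⟨x, mem_orbitUnion.2 hω⟩, Finset.mem_univ _, ?_⟩
      exact toPermOrbit_eq_iff.2 (Perm.sameCycle_subtypePerm.1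
        (toPermOrbit_eq_iff.1 (Quotient.out_eq _)))

theorem orbitUnion_singleton_of_not_fixed {ω : PermOrbit g} (hω : g ω.out ≠ ω.out) :
    orbitUnion g {ω} = (g.cycleOf ω.out).support := by
  ext x
  rw [mem_orbitUnion_singleton, Perm.mem_support_cycleOf_iff' hω]

theorem image_cycleOf_out (g : Perm α) :
    ({ω | g ω.out ≠ ω.out} : Finset (PermOrbit g)).image (fun ω => g.cycleOf ω.out) =
      g.cycleFactorsFinset := by
  ext c
  simp only [Finset.mem_image, Finset.mem_filter, Finset.mem_univ, true_and]
  constructor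
  · rintro ⟨ω, hω, rfl⟩
    exact Perm.cycleOf_mem_cycleFactorsFinset_iff.2 (Perm.mem_support.2 hω)
  · intro hc
    obtain ⟨x, hx⟩ := (Perm.mem_cycleFactorsFinset_iff.1 hc).1.nonempty_support
    have hout : g.SameCycle x (toPermOrbit g x).out :=
      toPermOrbit_eq_iff.1 (Quotient.out_eq _).symm
    have hxg := Perm.mem_support.1 (Perm.mem_cycleFactorsFinset_support_le hc hx)
    exact ⟨toPermOrbit g x, hout.apply_eq_self_iff.not.1 hxg,
      by rw [← hout.cycleOf_eq, ← Perm.cycle_is_cycleOf hx hc]⟩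

theorem injOn_cycleOf_out (g : Perm α) :
    Set.InjOn (fun ω : PermOrbit g => g.cycleOf ω.out) {ω | g ω.out ≠ ω.out} :=
  fun ω hω ω' hω' h => by
    rw [← Quotient.out_eq ω, ← Quotient.out_eq ω']
    exact toPermOrbit_eq_iff.2 ((Perm.sameCycle_iff_cycleOf_eq_of_mem_support
      (Perm.mem_support.2 hω) (Perm.mem_support.2 hω')).2 h)

theorem card_fixed_permOrbit (g : Perm α) :
    ({ω | g ω.out = ω.out} : Finset (PermOrbit g)).card = Fintype.card α - g.support.card := by
  rw [← Finset.card_compl]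
  refine Finset.card_nbij' Quotient.out (toPermOrbit g) (fun ω hω => by simpa using hω)
    (fun x hx => ?_) (fun ω _ => Quotient.out_eq ω) (fun x hx => ?_)
  all_goals
    have hfix : g x = x := by simpa using hx
    have hout : (toPermOrbit g x).out = x :=
      (toPermOrbit_eq_iff.1 (Quotient.out_eq (toPermOrbit g x))).eq_of_right hfix
  · simp [hout, hfix]
  · exact hout

theorem parts_partition_eq_map (g : Perm α) :
    g.partition.parts =
      (Finset.univ : Finset (PermOrbit g)).val.map fun ω => (orbitUnion g {ω}).card := by
  rw [Perm.parts_partition, Perm.cycleType_def, ← image_cycleOf_out,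
    Finset.image_val_of_injOn (by simpa using injOn_cycleOf_out g), Multiset.map_map,
    ← Multiset.filter_add_not (fun ω => g ω.out ≠ ω.out) Finset.univ.val, Multiset.map_add]
  congr 1
  · refine Multiset.map_congr rfl fun ω hω => ?_
    rw [orbitUnion_singleton_of_not_fixed (Multiset.mem_filter.1 hω).2]
    rfl
  · rw [← card_fixed_permOrbit]
    refine (Multiset.eq_replicate.2 ⟨?_, fun i hi => ?_⟩).symm
    · simp only [ne_eq, not_not, Multiset.card_map]
      rfl
    · obtain ⟨ω, hω, rfl⟩ := Multiset.mem_map.1 hi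
      exact card_orbitUnion_singleton_of_fixed (not_not.1 (Multiset.mem_filter.1 hω).2)

theorem sign_mul_neg_one_pow_card (g : Perm α) :
    (Perm.sign g : ℤ) * (-1) ^ Fintype.card α = (-1) ^ Fintype.card (PermOrbit g) := by
  have hcard := congrArg Multiset.card (parts_partition_eq_map g)
  rw [Multiset.card_map, ← Finset.card_def, Finset.card_univ, Perm.parts_partition,
    Multiset.card_add, Multiset.card_replicate] at hcard
  obtain ⟨m, hm⟩ := Nat.exists_eq_add_of_le (Finset.card_le_univ g.support)
  rw [← hcard, Perm.sign_of_cycleType, Perm.sum_cycleType, hm, Nat.add_sub_cancel_left]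
  simp only [Units.val_pow_eq_pow_val, Units.val_neg, Units.val_one, ← pow_add]
  rw [show g.support.card + g.cycleType.card + (g.support.card + m) =
    2 * g.support.card + (g.cycleType.card + m) by ring, pow_add, pow_mul, neg_one_sq, one_pow,
    one_mul]

theorem signOn_orbitUnion (g : Perm α) (T : Finset (PermOrbit g)) :
    signOn g (orbitUnion g T) * (-1) ^ (orbitUnion g T).card = (-1) ^ T.card := by
  rw [signOn, dif_pos (apply_mem_orbitUnion g T), ← card_permOrbit_subtypePerm g T,
    ← sign_mul_neg_one_pow_card, Fintype.card_coe]

/-- The polynomial `∏ (1 - X ^ m)`, which is `det (1 - X g)` on the permutation representation when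
the product is over the cycle lengths `m` of `g`. -/
noncomputable def oneSubPowProd (R : Type*) [CommRing R] (s : Multiset ℕ) : Polynomial R :=
  (s.map fun m => 1 - Polynomial.X ^ m).prod

theorem sum_signOn (R : Type*) [CommRing R] (g : Perm α) :
    ∑ S : Finset α, Polynomial.C ((signOn g S * (-1) ^ S.card : ℤ) : R) * Polynomial.X ^ S.card =
      oneSubPowProd R g.partition.parts := by
  have hparts : oneSubPowProd R g.partition.parts =
      ∏ ω : PermOrbit g, (1 + -Polynomial.X ^ (orbitUnion g {ω}).card) := by
    rw [oneSubPowProd, Finset.prod_eq_multiset_prod, parts_partition_eq_map, Multiset.map_map]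
    simp only [← sub_eq_add_neg, Function.comp_def]
  rw [hparts, Finset.prod_one_add, Finset.powerset_univ]
  symm
  refine Finset.sum_of_injOn (orbitUnion g) (orbitUnion_injective g).injOn (fun _ _ => by simp)
    (fun S _ hS => ?_) fun T _ => ?_
  · rw [signOn, dif_neg fun h => hS ⟨_, by simp, orbitUnion_image_toPermOrbit h⟩]
    simp
  · rw [signOn_orbitUnion, card_orbitUnion, Finset.prod_neg, Finset.prod_pow_eq_pow_sum]
    simp

theorem parts_partition_inv (g : Perm α) : g⁻¹.partition.parts = g.partition.parts := by
  rw [Perm.parts_partition, Perm.parts_partition, Perm.cycleType_inv, Perm.support_inv]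

variable {k : Type*} [Field k] [CharZero k]

theorem moduleChar_symSum_compl_mul_altSum_eq_coeff (g : Perm α) (S : Finset α) :
    (-1) ^ S.card * moduleChar (k := k) (Ideal.span {symSum k Sᶜ * altSum k S}) g =
      (oneSubPowProd k g.partition.parts).coeff S.card := by
  rw [← parts_partition_inv, ← sum_signOn, moduleChar_symSum_compl_mul_altSum,
    Polynomial.finsetSum_coeff, Finset.mul_sum, ← Finset.powerset_univ,
    Finset.powersetCard_eq_filter, Finset.sum_filter]
  refine Finset.sum_congr rfl fun S' _ => ?_
  rw [Polynomial.coeff_C_mul, Polynomial.coeff_X_pow]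
  by_cases h : S'.card = S.card
  · rw [if_pos h, if_pos h.symm, mul_one, h]
    push_cast
    rw [mul_comm]
  · rw [if_neg h, if_neg (Ne.symm h), mul_zero]

theorem moduleChar_symSum_compl_mul_altSum_insert (g : Perm α) {Q : Polynomial k}
    (hQ : (1 - Polynomial.X) * Q = oneSubPowProd k g.partition.parts)
    {S : Finset α} {x : α} (hx : x ∉ S) :
    (-1) ^ S.card * moduleChar (k := k) (Ideal.span {symSum k Sᶜ * altSum k (insert x S)}) g =
      Q.coeff S.card := by
  induction hm : S.card generalizing S x with
  | zero =>
    obtain rfl := Finset.card_eq_zero.1 hm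
    have hext := moduleChar_symSum_compl_mul_altSum_eq_coeff (k := k) g ∅
    rw [Finset.card_empty, ← hQ, Polynomial.mul_coeff_zero] at hext
    have haltSum : altSum k (insert x (∅ : Finset α)) = altSum k ∅ := by
      rw [altSum_insert (Finset.notMem_empty x)]
      simp
    rw [haltSum]
    simpa using hext
  | succ m ih =>
    obtain ⟨s, hs⟩ := Finset.card_pos.1 (m.succ_pos.trans_eq hm.symm)
    have hext := moduleChar_symSum_compl_mul_altSum_eq_coeff (k := k) g S
    have hprev := ih (Finset.notMem_erase s S) (by rw [Finset.card_erase_of_mem hs, hm]; rfl)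
    rw [Finset.insert_erase hs, Finset.compl_erase] at hprev
    rw [moduleChar_symSum_mul_altSum disjoint_compl_left (Finset.mem_compl.2 hx) hs, hm, ← hQ,
      sub_mul, one_mul, Polynomial.coeff_sub, Polynomial.coeff_X_mul, ← hprev] at hext
    linear_combination hext

end Orbits

/-! ### Hooks -/

section FiberPerms

open Equiv
open scoped Pointwise MonoidAlgebra

variable {α β : Type*} [Fintype α] [DecidableEq α] [DecidableEq β] {f : α → β}

/-- The permutations preserving every fiber of `f`; the row and column groups of a tableau are of
this form. -/
def fiberPerms (f : α → β) : Finset (Perm α) := {σ | ∀ i, f (σ i) = f i}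

theorem mem_fiberPerms {σ : Perm α} : σ ∈ fiberPerms f ↔ ∀ i, f (σ i) = f i := by
  simp [fiberPerms]

theorem fiberPerms_mul_fiberPerms_subset (f : α → β) :
    fiberPerms f * fiberPerms f ⊆ fiberPerms f :=
  Finset.mul_subset_iff.2 fun σ hσ τ hτ => mem_fiberPerms.2 fun i => by
    rw [Perm.mul_apply, mem_fiberPerms.1 hσ, mem_fiberPerms.1 hτ]

theorem swap_mem_fiberPerms {i j : α} (h : f i = f j) : swap i j ∈ fiberPerms f :=
  mem_fiberPerms.2 fun k => by
    obtain rfl | hi := eq_or_ne k i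
    · rw [swap_apply_left, h]
    obtain rfl | hj := eq_or_ne k j
    · rw [swap_apply_right, h]
    · rw [swap_apply_of_ne_of_ne hi hj]

theorem fiberPerms_eq_permsOn {A : Finset α} {b : β} (hA : ∀ i, i ∈ A ↔ f i = b)
    (hinj : ∀ i j, f i ≠ b → f i = f j → i = j) : fiberPerms f = permsOn A := by
  ext σ
  rw [mem_fiberPerms, mem_permsOn]
  refine ⟨fun h i hi => (hinj i _ (mt (hA i).2 hi) (h i).symm).symm, fun h i => ?_⟩
  by_cases hi : i ∈ A
  · rw [(hA _).1 ((apply_mem_iff_of_mem_permsOn (mem_permsOn.2 h)).2 hi), (hA i).1 hi]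
  · rw [h i hi]

theorem charSum_fiberPerms_mul_mul_charSum_permsOn {k : Type*} [CommRing k] [IsAddTorsionFree k]
    {ε δ : Perm α →* ℤˣ} (hεδ : ∀ i j, i ≠ j → ε (swap i j) ≠ δ (swap i j)) {T : Finset β}
    (hT : ∀ i, f i ∈ T) {A : Finset α} (hA : T.card < A.card) (x : k[Perm α]) :
    charSum k ε (fiberPerms f) * x * charSum k δ (permsOn A) = 0 := by
  refine charSum_mul_mul_charSum_eq_zero (fiberPerms_mul_fiberPerms_subset f)
    (permsOn_mul_permsOn_subset A) (fun g => ?_) x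
  obtain ⟨i, hi, j, hj, hij, h⟩ := Finset.exists_ne_map_eq_of_card_lt_of_maps_to hA
    (f := fun i => f (g i)) fun i _ => hT _
  refine ⟨swap (g i) (g j), swap_mem_fiberPerms h, ?_, ?_⟩
  · rw [swap_apply_apply]
    simpa [mul_assoc] using swap_mem_permsOn hi hj
  · rw [map_mul, map_mul, mul_right_comm, ← map_mul, inv_mul_cancel, map_one, one_mul]
    exact hεδ _ _ (g.injective.ne hij)

end FiberPerms

section Hooks

open Equiv

variable {d : ℕ} {k : ℕ}

/-- The hook `(d - k, 1, …, 1)` with leg length `k`. -/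
def hook (d k : ℕ) (hk : k < d) : Nat.Partition d where
  parts := (d - k) ::ₘ Multiset.replicate k 1
  parts_pos := by
    intro i hi
    obtain rfl | hi := Multiset.mem_cons.1 hi
    · exact Nat.sub_pos_of_lt hk
    · exact (Multiset.eq_of_mem_replicate hi).symm ▸ one_pos
  parts_sum := by
    rw [Multiset.sum_cons, Multiset.sum_replicate, smul_eq_mul, mul_one, Nat.sub_add_cancel hk.le]

theorem hook_injective (d : ℕ) : Function.Injective fun k : Fin d => hook d k k.2 := fun k l h => by
  simpa [hook, Fin.ext_iff] using congrArg (fun μ => Multiset.card μ.parts) h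

theorem partList_hook (hk : k < d) : partList (hook d k hk) = (d - k) :: List.replicate k 1 := by
  refine List.Perm.eq_of_sortedGE (partList_sorted _) (List.Pairwise.sortedGE ?_)
    (Multiset.coe_eq_coe.1 ((partList_coe _).trans rfl))
  refine List.pairwise_cons.2 ⟨fun b hb => ?_, List.pairwise_replicate.2 (Or.inr le_rfl)⟩
  rw [List.eq_of_mem_replicate hb]
  exact Nat.sub_pos_of_lt hk

theorem sum_get_eq_sum_range {M : Type*} [AddCommMonoid M] (w : List ℕ) (F : ℕ → ℕ → M) :
    ∑ i : Fin w.length, F (w.get i) i = ∑ i ∈ Finset.range w.length, F (w.getD i 0) i := by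
  rw [Finset.sum_range]
  simp

theorem shiftedPowerSum_hook (m : ℕ) (hk : k < d) :
    shiftedPowerSum m (hook d k hk) = ((d : ℚ) - k - 1 / 2) ^ m - (-((k : ℚ) + 1 / 2)) ^ m := by
  rw [shiftedPowerSum, sum_get_eq_sum_range _ fun a i : ℕ =>
    ((a : ℚ) - (i + 1) + 1 / 2) ^ m - (-(i + 1 : ℚ) + 1 / 2) ^ m, partList_hook,
    List.length_cons, List.length_replicate, Finset.sum_range_succ']
  have hleg : ∀ i ∈ Finset.range k,
      ((((d - k) :: List.replicate k 1).getD (i + 1) 0 : ℚ) - ((i + 1 : ℕ) + 1) + 1 / 2) ^ m -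
          (-((i + 1 : ℕ) + 1 : ℚ) + 1 / 2) ^ m =
        (-((i : ℚ) + 1 / 2)) ^ m - (-((i + 1 : ℕ) + 1 / 2 : ℚ)) ^ m := fun i hi => by
    simp only [List.getD_cons_succ, List.getD_replicate _ (Finset.mem_range.1 hi)]
    push_cast
    congr 2 <;> ring
  rw [Finset.sum_congr rfl hleg, Finset.sum_range_sub', List.getD_cons_zero, Nat.cast_sub hk.le]
  push_cast
  ring

/-- The cell, as a pair of a row and a column index, that the tableau numbers by `i`. -/
noncomputable abbrev cell (μ : Nat.Partition d) (i : Fin d) : ℕ × ℕ := (tableau μ i).1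

theorem cell_injective (μ : Nat.Partition d) : Function.Injective (cell μ) :=
  Subtype.val_injective.comp (tableau μ).injective

theorem cell_mem_diagram (μ : Nat.Partition d) (i : Fin d) : cell μ i ∈ (diagram μ).cells :=
  (tableau μ i).2

theorem exists_cell_eq {μ : Nat.Partition d} {c : ℕ × ℕ} (hc : c ∈ (diagram μ).cells) :
    ∃ i, cell μ i = c :=
  ⟨(tableau μ).symm ⟨c, hc⟩, congrArg Subtype.val ((tableau μ).apply_symm_apply _)⟩

theorem mem_diagram {μ : Nat.Partition d} {c : ℕ × ℕ} :
    c ∈ (diagram μ).cells ↔ ∃ h : c.1 < (partList μ).length, c.2 < (partList μ)[c.1] := by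
  rw [YoungDiagram.mem_cells, diagram, YoungDiagram.mem_ofRowLens]

theorem length_partList (μ : Nat.Partition d) : (partList μ).length = len μ := by
  rw [len, ← partList_coe, Multiset.coe_card]

theorem cell_fst_lt (μ : Nat.Partition d) (i : Fin d) : (cell μ i).1 < len μ :=
  length_partList μ ▸ (mem_diagram.1 (cell_mem_diagram μ i)).1

theorem cell_snd_lt (μ : Nat.Partition d) (i : Fin d) : (cell μ i).2 < (partList μ).headD 0 := by
  obtain ⟨hlen, hlt⟩ := mem_diagram.1 (cell_mem_diagram μ i)
  refine hlt.trans_le ?_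
  have hsorted := (partList_sorted μ).pairwise
  generalize partList μ = w at *
  cases w with
  | nil => exact absurd hlen (Nat.not_lt_zero _)
  | cons a w =>
    obtain h | h := List.mem_cons.1 (List.getElem_mem hlen)
    · exact h.le
    · exact (List.pairwise_cons.1 hsorted).1 _ h

theorem eq_replicate_one_of_sum_le_length {w : List ℕ} (hpos : ∀ x ∈ w, 0 < x)
    (h : w.sum ≤ w.length) : w = List.replicate w.length 1 := by
  induction w with
  | nil => rfl
  | cons a w ih =>
    rw [List.forall_mem_cons] at hpos
    have hle := List.length_le_sum_of_one_le w hpos.2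
    rw [List.sum_cons, List.length_cons] at h
    rw [List.length_cons, List.replicate_succ, ← ih hpos.2 (by omega), show a = 1 by omega]

theorem eq_hook_of_le {μ : Nat.Partition d} (hk : k < d) (hrow : d - k ≤ (partList μ).headD 0)
    (hcol : k < len μ) : μ = hook d k hk := by
  have hsum : (partList μ).sum = d := by rw [← Multiset.sum_coe, partList_coe, μ.parts_sum]
  have hpos := partList_pos μ
  rw [← length_partList] at hcol
  rw [Nat.Partition.ext_iff, ← partList_coe, ← partList_coe, partList_hook]
  generalize partList μ = w at *
  cases w with
  | nil => exact absurd hcol (Nat.not_lt_zero _)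
  | cons a w =>
    rw [List.forall_mem_cons] at hpos
    rw [List.headD_cons] at hrow
    rw [List.length_cons] at hcol
    rw [List.sum_cons] at hsum
    have hle := List.length_le_sum_of_one_le w hpos.2
    rw [eq_replicate_one_of_sum_le_length hpos.2 (by omega), show w.length = k by omega,
      show a = d - k by omega]

theorem youngSymmetrizer_eq (μ : Nat.Partition d) :
    youngSymmetrizer μ = charSum ℚ 1 (fiberPerms fun i => (cell μ i).1) *
      charSum ℚ Perm.sign (fiberPerms fun i => (cell μ i).2) := by
  have hsign : ∀ σ : Perm (Fin d), Perm.sign σ • MonoidAlgebra.of ℚ _ σ =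
      ((Perm.sign σ : ℤ) : ℚ) • MonoidAlgebra.of ℚ _ σ := fun σ => by
    rw [Units.smul_def, Int.cast_smul_eq_zsmul]
  simp only [youngSymmetrizer, charSum, hsign, MonoidHom.one_apply, one_smul, rowPerms, colPerms,
    fiberPerms]

section HookTableau

variable (hk : k < d)

theorem mem_diagram_hook {c : ℕ × ℕ} : c ∈ (diagram (hook d k hk)).cells ↔
    (c.1 = 0 ∧ c.2 < d - k) ∨ (c.2 = 0 ∧ 0 < c.1 ∧ c.1 ≤ k) := by
  obtain ⟨i, j⟩ := c
  simp only [mem_diagram, partList_hook, List.length_cons, List.length_replicate]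
  cases i with
  | zero => simp
  | succ i =>
    simp only [List.getElem_cons_succ, List.getElem_replicate, exists_prop]
    omega

theorem cell_hook (i : Fin d) : (cell (hook d k hk) i).1 = 0 ∨
    (cell (hook d k hk) i).2 = 0 ∧ (cell (hook d k hk) i).1 ≤ k := by
  have := (mem_diagram_hook hk).1 (cell_mem_diagram _ i)
  omega

theorem card_filter_cell_hook_fst_ne_zero :
    ({i | (cell (hook d k hk) i).1 ≠ 0} : Finset (Fin d)).card = k := by
  refine (Finset.card_bij (t := Finset.Icc 1 k) (fun i _ => (cell (hook d k hk) i).1)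
    (fun i hi => ?_) (fun i hi j hj h => ?_) fun b hb => ?_).trans (by simp)
  · have := cell_hook hk i
    simp only [Finset.mem_filter, Finset.mem_univ, true_and] at hi
    rw [Finset.mem_Icc]
    omega
  · simp only [Finset.mem_filter, Finset.mem_univ, true_and] at hi hj
    have hi' := cell_hook hk i
    have hj' := cell_hook hk j
    exact cell_injective _ (Prod.ext h (by omega))
  · obtain ⟨hb₁, hb₂⟩ := Finset.mem_Icc.1 hb
    obtain ⟨i, hi⟩ := exists_cell_eq
      ((mem_diagram_hook hk (c := (b, 0))).2 (Or.inr ⟨rfl, hb₁, hb₂⟩))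
    exact ⟨i, by simp [hi, Nat.ne_of_gt hb₁], by rw [hi]⟩

theorem exists_youngSymmetrizer_hook_eq : ∃ (S : Finset (Fin d)) (x : Fin d), S.card = k ∧ x ∉ S ∧
    youngSymmetrizer (hook d k hk) = symSum ℚ Sᶜ * altSum ℚ (insert x S) := by
  obtain ⟨x, hx⟩ := exists_cell_eq ((mem_diagram_hook hk (c := (0, 0))).2
    (Or.inl ⟨rfl, Nat.sub_pos_of_lt hk⟩))
  set S : Finset (Fin d) := {i | (cell (hook d k hk) i).1 ≠ 0} with hS
  have hrow : ∀ i, i ∈ Sᶜ ↔ (cell (hook d k hk) i).1 = 0 := fun i => by simp [hS]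
  have hcol : ∀ i, i ∈ insert x S ↔ (cell (hook d k hk) i).2 = 0 := fun i => by
    have hi := cell_hook hk i
    rw [Finset.mem_insert, ← (cell_injective (hook d k hk)).eq_iff, hx, Prod.ext_iff, hS,
      Finset.mem_filter]
    simp only [Finset.mem_univ, true_and]
    omega
  refine ⟨S, x, card_filter_cell_hook_fst_ne_zero hk, by simp [hS, hx], ?_⟩
  rw [youngSymmetrizer_eq, fiberPerms_eq_permsOn hrow, fiberPerms_eq_permsOn hcol]
  all_goals
    intro i j hi h
    have hi' := cell_hook hk i
    have hj' := cell_hook hk j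
    exact cell_injective (hook d k hk) (Prod.ext (by omega) (by omega))

end HookTableau

theorem youngSymmetrizer_mul_mul_youngSymmetrizer_hook {μ : Nat.Partition d} (hk : k < d)
    (hμ : μ ≠ hook d k hk) (x : MonoidAlgebra ℚ (Perm (Fin d))) :
    youngSymmetrizer μ * x * youngSymmetrizer (hook d k hk) = 0 := by
  obtain ⟨S, y, hS, hy, hhook⟩ := exists_youngSymmetrizer_hook_eq hk
  rw [hhook, youngSymmetrizer_eq]
  by_cases hrow : d - k ≤ (partList μ).headD 0
  · have hcard : (Finset.range (len μ)).card < (insert y S).card := by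
      rw [Finset.card_insert_of_notMem hy, hS, Finset.card_range]
      exact lt_of_not_ge fun h => hμ (eq_hook_of_le hk hrow h)
    have hzero := charSum_fiberPerms_mul_mul_charSum_permsOn (ε := 1) (δ := Perm.sign)
      (fun i j hij => by simp [Perm.sign_swap hij])
      (fun i => Finset.mem_range.2 (cell_fst_lt μ i)) hcard
      (charSum ℚ Perm.sign (fiberPerms fun i => (cell μ i).2) * x * symSum ℚ Sᶜ)
    simpa only [mul_assoc] using hzero
  · have hcard : (Finset.range ((partList μ).headD 0)).card < Sᶜ.card := by
      rw [Finset.card_compl, Fintype.card_fin, hS, Finset.card_range]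
      exact not_le.1 hrow
    have hzero := charSum_fiberPerms_mul_mul_charSum_permsOn (ε := Perm.sign) (δ := 1)
      (fun i j hij => by simp [Perm.sign_swap hij])
      (fun i => Finset.mem_range.2 (cell_snd_lt μ i)) hcard x
    rw [mul_assoc (charSum ℚ 1 _), mul_assoc (charSum ℚ 1 _), ← mul_assoc (_ * x), hzero, zero_mul,
      mul_zero]

end Hooks

section HookCharacters

open Equiv

variable {d : ℕ}

theorem exists_one_sub_X_mul_eq_oneSubPowProd {s : Multiset ℕ} (hs : s ≠ 0) :
    ∃ Q : Polynomial ℚ, (1 - Polynomial.X) * Q = oneSubPowProd ℚ s ∧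
      Q.eval 1 = if Multiset.card s = 1 then (s.sum : ℚ) else 0 := by
  obtain ⟨a, ha⟩ := Multiset.exists_mem_of_ne_zero hs
  obtain ⟨t, rfl⟩ := Multiset.exists_cons_of_mem ha
  refine ⟨(∑ i ∈ Finset.range a, Polynomial.X ^ i) * oneSubPowProd ℚ t, ?_, ?_⟩
  · rw [← mul_assoc, mul_neg_geom_sum, oneSubPowProd, oneSubPowProd, Multiset.map_cons,
      Multiset.prod_cons]
  · rw [Multiset.card_cons, Multiset.sum_cons, Polynomial.eval_mul, Polynomial.eval_finsetSum]
    obtain rfl | ⟨b, hb⟩ := Multiset.empty_or_exists_mem t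
    · simp [oneSubPowProd]
    · obtain ⟨u, rfl⟩ := Multiset.exists_cons_of_mem hb
      simp [oneSubPowProd]

theorem natDegree_oneSubPowProd_le (s : Multiset ℕ) : (oneSubPowProd ℚ s).natDegree ≤ s.sum := by
  refine (Polynomial.natDegree_multiset_prod_le _).trans ?_
  rw [Multiset.map_map]
  conv_rhs => rw [← Multiset.map_id s]
  exact Multiset.sum_map_le_sum_map _ _ fun m _ => (Polynomial.natDegree_sub_le _ _).trans (by simp)

theorem natDegree_lt_of_mul_eq_oneSubPowProd {s : Multiset ℕ} {Q : Polynomial ℚ}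
    (hQ : (1 - Polynomial.X) * Q = oneSubPowProd ℚ s) (hs : 0 < s.sum) : Q.natDegree < s.sum := by
  obtain rfl | hQ₀ := eq_or_ne Q 0
  · simpa using hs
  have hdeg : (1 - Polynomial.X : Polynomial ℚ).natDegree = 1 := by
    rw [← neg_sub, Polynomial.natDegree_neg]
    exact Polynomial.natDegree_X_sub_C 1
  have hmul := Polynomial.natDegree_mul (Polynomial.ne_zero_of_natDegree_gt (hdeg ▸ one_pos)) hQ₀
  have := natDegree_oneSubPowProd_le s
  rw [hQ, hdeg] at hmul
  omega

/-- The cycle type of a permutation of `Fin d` as a partition of `d`. -/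
def cyclePartition (σ : Perm (Fin d)) : Nat.Partition d where
  parts := σ.partition.parts
  parts_pos := σ.partition.parts_pos
  parts_sum := σ.partition.parts_sum.trans (Fintype.card_fin d)

theorem cyclePartition_inv (σ : Perm (Fin d)) : cyclePartition σ⁻¹ = cyclePartition σ :=
  Nat.Partition.ext (parts_partition_inv σ)

theorem cyclePartition_surjective : Function.Surjective (cyclePartition (d := d)) := fun ν =>
  (exists_perm_parts ν).imp fun _ h => Nat.Partition.ext h

theorem irrChar_cyclePartition (μ : Nat.Partition d) (σ : Perm (Fin d)) :
    irrChar μ (cyclePartition σ) = moduleChar (k := ℚ) (spechtIdeal μ) σ :=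
  irrChar_eq μ _ σ rfl

theorem sum_irrChar_mul_irrChar_eq_zero {μ μ' : Nat.Partition d}
    (h : ∀ x, youngSymmetrizer μ * x * youngSymmetrizer μ' = 0) :
    ∑ σ : Perm (Fin d), irrChar μ' (cyclePartition σ) * irrChar μ (cyclePartition σ) = 0 := by
  have : Subsingleton (spechtIdeal μ →ₗ[MonoidAlgebra ℚ (Perm (Fin d))] spechtIdeal μ') :=
    subsingleton_linearMap_span_singleton h
  rw [← sum_moduleChar_mul_inv_eq_zero (k := ℚ) (G := Perm (Fin d)) (M := spechtIdeal μ)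
    (N := spechtIdeal μ')]
  refine Finset.sum_congr rfl fun σ _ => ?_
  rw [← irrChar_cyclePartition, ← irrChar_cyclePartition, cyclePartition_inv]

theorem irrChar_hook {k : ℕ} (hk : k < d) {ν : Nat.Partition d} {Q : Polynomial ℚ}
    (hQ : (1 - Polynomial.X) * Q = oneSubPowProd ℚ ν.parts) :
    irrChar (hook d k hk) ν = (-1) ^ k * Q.coeff k := by
  obtain ⟨σ, rfl⟩ := cyclePartition_surjective ν
  obtain ⟨S, x, rfl, hx, hhook⟩ := exists_youngSymmetrizer_hook_eq hk
  rw [irrChar_cyclePartition, spechtIdeal, hhook,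
    ← moduleChar_symSum_compl_mul_altSum_insert σ hQ hx, ← mul_assoc, ← mul_pow,
    neg_one_mul, neg_neg, one_pow, one_mul]

theorem irrChar_hook_indiscrete {k : ℕ} (hk : k < d) :
    irrChar (hook d k hk) (Nat.Partition.indiscrete d) = (-1) ^ k := by
  rw [irrChar_hook hk (Q := ∑ i ∈ Finset.range d, Polynomial.X ^ i)]
  · simp [Polynomial.finsetSum_coeff, Polynomial.coeff_X_pow, hk]
  · rw [mul_neg_geom_sum, Nat.Partition.indiscrete_parts (Nat.ne_zero_of_lt hk)]
    simp [oneSubPowProd]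

theorem parts_ne_zero (hd : d ≠ 0) (ν : Nat.Partition d) : ν.parts ≠ 0 := fun h =>
  hd (by rw [← ν.parts_sum, h, Multiset.sum_zero])

theorem eq_indiscrete_iff_card_parts (hd : d ≠ 0) (ν : Nat.Partition d) :
    ν = Nat.Partition.indiscrete d ↔ Multiset.card ν.parts = 1 := by
  rw [Nat.Partition.ext_iff, Nat.Partition.indiscrete_parts hd, Multiset.card_eq_one]
  refine ⟨fun h => ⟨d, h⟩, ?_⟩
  rintro ⟨a, ha⟩
  rw [ha, ← ν.parts_sum, ha, Multiset.sum_singleton]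

theorem sum_neg_one_pow_mul_irrChar_hook (hd : d ≠ 0) (ν : Nat.Partition d) :
    ∑ k : Fin d, (-1) ^ (k : ℕ) * irrChar (hook d k k.2) ν =
      if ν = Nat.Partition.indiscrete d then (d : ℚ) else 0 := by
  obtain ⟨Q, hQ, hQ_eval⟩ := exists_one_sub_X_mul_eq_oneSubPowProd (parts_ne_zero hd ν)
  have hdeg := natDegree_lt_of_mul_eq_oneSubPowProd hQ
    (ν.parts_sum.symm ▸ Nat.pos_of_ne_zero hd)
  rw [ν.parts_sum] at hQ_eval hdeg
  simp only [eq_indiscrete_iff_card_parts hd]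
  rw [← hQ_eval, Polynomial.eval_eq_sum_range' hdeg, Finset.sum_range]
  refine Finset.sum_congr rfl fun k _ => ?_
  rw [irrChar_hook k.2 hQ, ← mul_assoc, ← mul_pow]
  simp

theorem irrChar_indiscrete_eq_zero (hd : d ≠ 0) {μ : Nat.Partition d}
    (hμ : ∀ k (hk : k < d), μ ≠ hook d k hk) : irrChar μ (Nat.Partition.indiscrete d) = 0 := by
  have hsum : ∑ σ : Perm (Fin d), (∑ k : Fin d, (-1) ^ (k : ℕ) *
      irrChar (hook d k k.2) (cyclePartition σ)) * irrChar μ (cyclePartition σ) = 0 := by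
    simp only [Finset.sum_mul, mul_assoc]
    rw [Finset.sum_comm]
    refine Finset.sum_eq_zero fun k _ => ?_
    rw [← Finset.mul_sum, sum_irrChar_mul_irrChar_eq_zero
      (youngSymmetrizer_mul_mul_youngSymmetrizer_hook k.2 (hμ k k.2)), mul_zero]
  simp only [sum_neg_one_pow_mul_irrChar_hook hd, ite_mul, zero_mul] at hsum
  obtain ⟨σ, hσ⟩ := cyclePartition_surjective (Nat.Partition.indiscrete d)
  rw [← Finset.sum_filter, Finset.sum_congr rfl fun τ hτ => by rw [(Finset.mem_filter.1 hτ).2],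
    Finset.sum_const, smul_eq_zero, mul_eq_zero, Finset.card_eq_zero, Nat.cast_eq_zero] at hsum
  exact (hsum.resolve_left (Finset.ne_empty_of_mem
    (Finset.mem_filter.2 ⟨Finset.mem_univ σ, hσ⟩))).resolve_left hd

theorem sum_irrChar_indiscrete_mul (hd : d ≠ 0) (ν : Nat.Partition d) (F : Nat.Partition d → ℚ)
    {Q : Polynomial ℚ} (hQ : (1 - Polynomial.X) * Q = oneSubPowProd ℚ ν.parts) :
    ∑ μ : Nat.Partition d, irrChar μ (Nat.Partition.indiscrete d) * F μ * irrChar μ ν =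
      ∑ k : Fin d, Q.coeff k * F (hook d k k.2) := by
  symm
  refine Finset.sum_of_injOn (fun k : Fin d => hook d k k.2) (hook_injective d).injOn
    (fun _ _ => by simp) (fun μ _ hμ => ?_) fun k _ => ?_
  · rw [irrChar_indiscrete_eq_zero hd fun k hk h => hμ ⟨⟨k, hk⟩, by simp, h.symm⟩, zero_mul,
      zero_mul]
  · rw [irrChar_hook_indiscrete, irrChar_hook k.2 hQ]
    have hsq : (-1 : ℚ) ^ (k : ℕ) * (-1) ^ (k : ℕ) = 1 := by rw [← mul_pow]; simp
    linear_combination -(Q.coeff k * F (hook d k k.2)) * hsq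

end HookCharacters

section HookSeries

open PowerSeries

/-- The power series `exp (c x)`. -/
noncomputable def expOf (c : ℚ) : ℚ⟦X⟧ := rescale c (exp ℚ)

theorem expOf_add (a b : ℚ) : expOf (a + b) = expOf a * expOf b :=
  (exp_mul_exp_eq_exp_add a b).symm

theorem expOf_zero : expOf 0 = 1 := by
  rw [expOf, rescale_zero_apply, constantCoeff_exp, map_one]

theorem expOf_natCast_mul (k : ℕ) (c : ℚ) : expOf (k * c) = expOf c ^ k := by
  rw [expOf, expOf, rescale_mul, RingHom.comp_apply, ← exp_pow_eq_rescale_exp]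
  simp

theorem expOf_sum {ι : Type*} (s : Finset ι) (f : ι → ℚ) :
    expOf (∑ i ∈ s, f i) = ∏ i ∈ s, expOf (f i) := by
  classical
  induction s using Finset.induction_on with
  | empty => simp [expOf_zero]
  | insert a s ha ih => rw [Finset.sum_insert ha, Finset.prod_insert ha, expOf_add, ih]

theorem coeff_expOf (c : ℚ) (m : ℕ) : coeff m (expOf c) = c ^ m / (m ! : ℚ) := by
  rw [expOf, coeff_rescale, coeff_exp]
  simp [div_eq_mul_inv]

theorem expOf_sub_expOf_neg (c : ℚ) :
    expOf c - expOf (-c) = C (2 * c) * X * rescale c sinhDivX := by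
  have hC : (C (2 * c) : ℚ⟦X⟧) * X = C 2 * rescale c X := by rw [rescale_X, map_mul, mul_assoc]
  have hC_half : rescale c (C (1 / 2 : ℚ)) = C (1 / 2) := by
    ext m
    rw [coeff_rescale, coeff_C]
    split_ifs with hm <;> simp [hm]
  rw [hC, mul_assoc, ← map_mul, X_mul_sinhDivX, map_mul, hC_half, ← mul_assoc, ← map_mul, map_sub,
    evalNegHom, rescale_rescale, expOf, expOf]
  norm_num

theorem expOf_sub_expOf_neg_eq_mul (c : ℚ) :
    expOf c - expOf (-c) = expOf c * (1 - expOf (c * (-2))) := by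
  rw [mul_sub, mul_one, ← expOf_add]
  ring_nf

theorem constantCoeff_sinhDivX : constantCoeff sinhDivX = 1 := by
  rw [← coeff_zero_eq_constantCoeff_apply, sinhDivX, coeff_mk]
  simp

theorem sum_coeff_mul_expOf_mul {ι : Type*} [Fintype ι] (β : ι → ℕ) {d : ℕ} (hd : ∑ i, β i = d)
    {Q : Polynomial ℚ} (hQ : (1 - Polynomial.X) * Q = ∏ i, (1 - Polynomial.X ^ β i))
    (hdeg : Q.natDegree < d) :
    (∑ k : Fin d, C (Q.coeff k) * expOf (d - 1 - 2 * k)) * (expOf 1 - expOf (-1)) =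
      ∏ i, (expOf (β i) - expOf (-β i)) := by
  have hsum : ∑ k : Fin d, C (Q.coeff k) * expOf (d - 1 - 2 * k) =
      expOf (d - 1) * Polynomial.aeval (expOf (-2)) Q := by
    rw [Polynomial.aeval_eq_sum_range' hdeg, Finset.mul_sum, Finset.sum_range]
    refine Finset.sum_congr rfl fun k _ => ?_
    rw [show (d : ℚ) - 1 - 2 * k = (d - 1) + (k : ℕ) * (-2) by ring, expOf_add,
      expOf_natCast_mul, smul_eq_C_mul, mul_left_comm]
  have haeval := congrArg (Polynomial.aeval (expOf (-2))) hQ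
  simp only [map_mul, map_prod, map_sub, map_one, map_pow, Polynomial.aeval_X,
    ← expOf_natCast_mul] at haeval
  calc _ = expOf (d - 1) * expOf 1 * ((1 - expOf (-2)) * Polynomial.aeval (expOf (-2)) Q) := by
        rw [hsum, expOf_sub_expOf_neg_eq_mul 1, one_mul]; ring
    _ = ∏ i, (expOf (β i) - expOf (-β i)) := by
        rw [haeval, ← expOf_add, sub_add_cancel, ← hd, Nat.cast_sum, expOf_sum,
          ← Finset.prod_mul_distrib]
        simp only [expOf_sub_expOf_neg_eq_mul]

theorem sum_coeff_mul_expOf_mul_sinhDivX {n : ℕ} (β : Fin (n + 1) → ℕ) {d : ℕ}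
    (hd : ∑ i, β i = d) {Q : Polynomial ℚ}
    (hQ : (1 - Polynomial.X) * Q = ∏ i, (1 - Polynomial.X ^ β i)) (hdeg : Q.natDegree < d) :
    (∑ k : Fin d, C (Q.coeff k) * expOf (d - 1 - 2 * k)) * sinhDivX =
      C (2 ^ n * ∏ i, (β i : ℚ)) * X ^ n * ∏ i, rescale (β i : ℚ) sinhDivX := by
  have h := sum_coeff_mul_expOf_mul β hd hQ hdeg
  simp only [expOf_sub_expOf_neg, Finset.prod_mul_distrib, Finset.prod_const, Finset.card_univ,
    Fintype.card_fin, ← map_prod, rescale_one, RingHom.id_apply] at h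
  have hne : C (2 * 1 : ℚ) * X ≠ 0 :=
    mul_ne_zero ((map_ne_zero_iff _ C_injective).2 (by norm_num)) X_ne_zero
  refine mul_left_cancel₀ hne ?_
  rw [mul_left_comm, h]
  simp only [map_mul, map_pow, map_one]
  ring

/-- The power series `∏ᵢ sinh (xᵢ x) / (xᵢ x)`, as a series in `x` over `ℚ[x₁, …, xₙ]`. -/
noncomputable def sinhProd (n : ℕ) : (MvPolynomial (Fin n) ℚ)⟦X⟧ :=
  ∏ i, rescale (MvPolynomial.X i) (map MvPolynomial.C sinhDivX)

/-- The power series `(∏ᵢ sinh (xᵢ x) / (xᵢ x)) / (sinh x / x)`. -/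
noncomputable def sinhQuot (n : ℕ) : (MvPolynomial (Fin n) ℚ)⟦X⟧ :=
  sinhProd n * map MvPolynomial.C sinhDivX⁻¹

theorem map_eval_sinhQuot {n : ℕ} (x : Fin n → ℚ) :
    map (MvPolynomial.eval x) (sinhQuot n) = (∏ i, rescale (x i) sinhDivX) * sinhDivX⁻¹ := by
  have hC : (MvPolynomial.eval x).comp MvPolynomial.C = RingHom.id ℚ := by ext; simp
  have hmap (f : ℚ⟦X⟧) : map (MvPolynomial.eval x) (map MvPolynomial.C f) = f := by
    rw [← RingHom.comp_apply, ← map_comp, hC, map_id]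
    rfl
  simp only [sinhQuot, sinhProd, map_mul, map_prod, ← rescale_map, MvPolynomial.eval_X, hmap]

theorem sum_coeff_mul_pow {n : ℕ} (β : Fin (n + 1) → ℕ) {d : ℕ} (hd : ∑ i, β i = d)
    {Q : Polynomial ℚ} (hQ : (1 - Polynomial.X) * Q = ∏ i, (1 - Polynomial.X ^ β i))
    (hdeg : Q.natDegree < d) (m : ℕ) :
    ∑ k : Fin d, Q.coeff k * ((d : ℚ) - 1 - 2 * k) ^ m =
      if n ≤ m then (m ! : ℚ) * 2 ^ n * (∏ i, (β i : ℚ)) *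
        MvPolynomial.eval (fun i => (β i : ℚ)) (coeff (m - n) (sinhQuot (n + 1)))
      else 0 := by
  have hm : (m ! : ℚ) ≠ 0 := Nat.cast_ne_zero.2 (Nat.factorial_ne_zero m)
  have hinv : sinhDivX * sinhDivX⁻¹ = 1 :=
    PowerSeries.mul_inv_cancel _ (by rw [constantCoeff_sinhDivX]; exact one_ne_zero)
  have h := congrArg (fun f => (m ! : ℚ) * coeff m (f * sinhDivX⁻¹))
    (sum_coeff_mul_expOf_mul_sinhDivX β hd hQ hdeg)
  simp only [mul_assoc, hinv, mul_one, coeff_C_mul, coeff_X_pow_mul', map_sum, coeff_expOf,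
    Finset.mul_sum, ← map_eval_sinhQuot, coeff_map] at h
  calc _ = _ := Finset.sum_congr rfl fun k _ => by field_simp
    _ = _ := h
    _ = _ := by split_ifs <;> ring

end HookSeries

section Polynomiality

variable {n d : ℕ}

theorem ofVec_parts_eq_filter (a : Fin n → ℕ) :
    (ofVec a).parts = (Finset.univ.val.map a).filter (· ≠ 0) := rfl

theorem ofVec_parts (β : Fin n → ℕ) (hβ : ∀ i, 0 < β i) :
    (ofVec β).parts = Finset.univ.val.map β := by
  rw [ofVec_parts_eq_filter, Multiset.filter_eq_self.2]
  intro a ha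
  obtain ⟨i, -, rfl⟩ := Multiset.mem_map.1 ha
  exact (hβ i).ne'

theorem oneSubPowProd_ofVec (β : Fin n → ℕ) (hβ : ∀ i, 0 < β i) :
    oneSubPowProd ℚ (ofVec β).parts = ∏ i, (1 - Polynomial.X ^ β i) := by
  rw [oneSubPowProd, ofVec_parts β hβ, Multiset.map_map]
  rfl

theorem mul_doubleHurwitz_indiscrete (hd : d ≠ 0) (g r : ℕ) (ν : Nat.Partition d)
    {Q : Polynomial ℚ} (hQ : (1 - Polynomial.X) * Q = oneSubPowProd ℚ ν.parts) :
    (d : ℚ) * doubleHurwitz g r (Nat.Partition.indiscrete d) ν =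
      (∑ k : Fin d, Q.coeff k * (shiftedPowerSum (r + 1) (hook d k k.2) / ((r + 1)! : ℚ)) ^
        ((2 * g + 1 + len ν - 2) / r)) / ν.parts.prod := by
  have hlen : len (Nat.Partition.indiscrete d) = 1 := by
    rw [len, Nat.Partition.indiscrete_parts hd, Multiset.card_singleton]
  rw [doubleHurwitz, hlen, sum_irrChar_indiscrete_mul hd ν
    (fun μ => (shiftedPowerSum (r + 1) μ / ((r + 1)! : ℚ)) ^ _) hQ,
    Nat.Partition.indiscrete_parts hd, Multiset.prod_singleton]
  have := Nat.cast_ne_zero (R := ℚ).2 hd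
  field_simp

theorem shiftedPowerSum_three_hook {k : ℕ} (hk : k < d) :
    shiftedPowerSum 3 (hook d k hk) / (3 ! : ℚ) =
      (d ^ 3 / 3 + d * ((d : ℚ) - 1 - 2 * k) ^ 2) / 8 := by
  rw [shiftedPowerSum_hook, show ((3 ! : ℕ) : ℚ) = 6 by norm_num [Nat.factorial]]
  ring

theorem cube_add_mul_sq_pow_div_factorial (x y : ℚ) (s : ℕ) :
    ((x ^ 3 / 3 + x * y ^ 2) / 8) ^ s / (s ! : ℚ) = ∑ h ∈ Finset.range (s + 1),
      x ^ (s + 2 * h) / ((h ! : ℚ) * ((s - h)! : ℚ) * 3 ^ h * 8 ^ s) * y ^ (2 * (s - h)) := by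
  rw [div_pow, add_pow, Finset.sum_div, Finset.sum_div]
  refine Finset.sum_congr rfl fun h hh => ?_
  obtain ⟨u, rfl⟩ := Nat.exists_eq_add_of_le (Nat.lt_succ_iff.1 (Finset.mem_range.1 hh))
  have hs := Nat.cast_ne_zero (R := ℚ).2 (Nat.factorial_ne_zero (h + u))
  rw [Nat.cast_choose ℚ (Nat.le_add_right h u), Nat.add_sub_cancel_left, div_pow, mul_pow]
  field_simp
  ring

/-- The polynomial `d H^{g,(2)}_{(d),β} / s!` in `2 r + 1` variables: the sum over `h` comes from
the binomial expansion of the power of `p₃ / 3!`, and the coefficients of `sinhQuot` are the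
resulting power sums over hooks. -/
noncomputable def explicitPolynomial (g r : ℕ) : MvPolynomial (Fin (2 * r + 1)) ℚ :=
  MvPolynomial.C (1 / 2 ^ (3 * g + r)) * ∑ h ∈ Finset.range (g + 1),
    MvPolynomial.C (((2 * (g + r) - 2 * h)! : ℚ) / ((h ! : ℚ) * ((g + r - h)! : ℚ) * 3 ^ h)) *
      ((∑ i, MvPolynomial.X i) ^ (g + r + 2 * h) *
        PowerSeries.coeff (2 * (g - h)) (sinhQuot (2 * r + 1)))

theorem sum_coeff_mul_shiftedPowerSum_three_pow (g : ℕ) {r : ℕ} (β : Fin (2 * r + 1) → ℕ)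
    (hd : ∑ i, β i = d) {Q : Polynomial ℚ}
    (hQ : (1 - Polynomial.X) * Q = ∏ i, (1 - Polynomial.X ^ β i)) (hdeg : Q.natDegree < d) :
    (∑ k : Fin d, Q.coeff k * (shiftedPowerSum 3 (hook d k k.2) / (3 ! : ℚ)) ^ (g + r)) /
        ((g + r)! : ℚ) =
      (∏ i, (β i : ℚ)) * MvPolynomial.eval (fun i => (β i : ℚ)) (explicitPolynomial g r) := by
  simp only [shiftedPowerSum_three_hook, Finset.sum_div, mul_div_assoc,
    cube_add_mul_sq_pow_div_factorial, Finset.mul_sum (Finset.range _)]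
  rw [Finset.sum_comm]
  simp only [mul_left_comm (Q.coeff _), ← Finset.mul_sum]
  simp only [sum_coeff_mul_pow β hd hQ hdeg]
  rw [show g + r + 1 = (g + 1) + r by ring, Finset.sum_range_add,
    Finset.sum_eq_zero (s := Finset.range r), add_zero]
  · simp only [explicitPolynomial, map_mul, map_sum, map_pow, MvPolynomial.eval_C,
      MvPolynomial.eval_X, Finset.mul_sum]
    refine Finset.sum_congr rfl fun h hh => ?_
    have hhg : h ≤ g := Nat.lt_succ_iff.1 (Finset.mem_range.1 hh)
    rw [if_pos (by omega), show 2 * (g + r - h) - 2 * r = 2 * (g - h) by omega,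
      show 2 * (g + r - h) = 2 * (g + r) - 2 * h by omega, ← Nat.cast_sum, hd,
      show (8 : ℚ) ^ (g + r) = 2 ^ (3 * g + r) * 2 ^ (2 * r) by
        rw [show (8 : ℚ) = 2 ^ 3 by norm_num, ← pow_mul, ← pow_add]; ring_nf]
    field_simp
  · intro h hh
    rw [if_neg (by have := Finset.mem_range.1 hh; omega), mul_zero]

theorem isHurwitzPolynomial_explicitPolynomial (g r : ℕ) :
    IsHurwitzPolynomial g (2 * r + 1) (explicitPolynomial g r) := by
  intro β hβ
  have hd : 0 < ∑ i, β i := Finset.sum_pos (fun i _ => hβ i) Finset.univ_nonempty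
  obtain ⟨Q, hQ, -⟩ := exists_one_sub_X_mul_eq_oneSubPowProd (parts_ne_zero hd.ne' (ofVec β))
  have hdeg := natDegree_lt_of_mul_eq_oneSubPowProd hQ ((ofVec β).parts_sum.symm ▸ hd)
  rw [(ofVec β).parts_sum] at hdeg
  have hprod : ((ofVec β).parts.prod : ℚ) = ∏ i, (β i : ℚ) := by
    rw [ofVec_parts β hβ, Finset.prod_map_val, Nat.cast_prod]
  have hprod₀ : (∏ i, (β i : ℚ)) ≠ 0 :=
    Finset.prod_ne_zero_iff.2 fun i _ => Nat.cast_ne_zero.2 (hβ i).ne'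
  have hlen : len (ofVec β) = 2 * r + 1 := by
    rw [len, ofVec_parts β hβ]; simp
  rw [mul_doubleHurwitz_indiscrete hd.ne' g 2 _ hQ, hlen, hprod,
    show (2 * g + 1 + (2 * r + 1) - 2) / 2 = g + r by omega,
    show g + (2 * r + 1 - 1) / 2 = g + r by omega, div_right_comm,
    sum_coeff_mul_shiftedPowerSum_three_pow g β rfl (oneSubPowProd_ofVec β hβ ▸ hQ) hdeg,
    mul_div_cancel_left₀ _ hprod₀]

end Polynomiality

/-! ### The exponential formula -/

section LogDerivative

open PowerSeries

variable {A : Type*} [CommRing A]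

theorem derivation_prod_eq_prod_mul_sum {R ι : Type*} [CommRing R] [Algebra R A]
    (δ : Derivation R A A) (s : Finset ι) {f g : ι → A} (h : ∀ i ∈ s, δ (f i) = f i * g i) :
    δ (∏ i ∈ s, f i) = (∏ i ∈ s, f i) * ∑ i ∈ s, g i := by
  classical
  induction s using Finset.induction_on with
  | empty => simp
  | insert a s ha ih =>
    rw [Finset.prod_insert ha, Finset.sum_insert ha, Derivation.leibniz, h a (by simp),
      ih fun i hi => h i (by simp [hi]), smul_eq_mul, smul_eq_mul]
    ring

theorem derivative_rescale (a : A) (f : A⟦X⟧) :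
    derivative A (rescale a f) = C a * rescale a (derivative A f) := by
  ext m
  simp only [coeff_derivative, coeff_rescale, coeff_C_mul]
  ring

theorem derivative_map {B : Type*} [CommRing B] (e : A →+* B) (f : A⟦X⟧) :
    derivative B (map e f) = map e (derivative A f) := by
  ext m
  simp [coeff_derivative]

variable [Algebra ℚ A]

theorem derivative_log_mul_one_add_X : derivative A (log A) * (1 + X) = 1 := by
  rw [deriv_log]
  ext m
  cases m with
  | zero => simp [mul_add, coeff_one]
  | succ m => simp [mul_add, coeff_succ_mul_X, coeff_one, pow_succ]

theorem derivative_eq_mul_derivative_logOf {f : A⟦X⟧} (hf : constantCoeff f = 1) :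
    derivative A f = f * derivative A (logOf f) := by
  have hs : HasSubst (f - 1) := HasSubst.of_constantCoeff_zero' (by rw [map_sub, hf]; simp)
  have h := congrArg (subst (f - 1)) (derivative_log_mul_one_add_X (A := A))
  rw [subst_mul hs, subst_add hs, subst_X hs, ← coe_substAlgHom hs, map_one, add_sub_cancel,
    coe_substAlgHom hs] at h
  rw [logOf_eq, derivative_subst hs, ← mul_assoc, mul_comm f, h, one_mul, map_sub, derivative_one,
    sub_zero]

theorem rescale_logOf (a : A) {f : A⟦X⟧} (hf : constantCoeff f = 1) :
    rescale a (logOf f) = logOf (rescale a f) := by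
  have hs : HasSubst (f - 1) := HasSubst.of_constantCoeff_zero' (by rw [map_sub, hf]; simp)
  rw [logOf_eq, logOf_eq, rescale_eq_subst, subst_comp_subst_apply hs (HasSubst.smul_X' a),
    ← rescale_eq_subst, map_sub, map_one]

end LogDerivative

section PartitionSum

variable {A : Type*} [CommRing A] [Algebra ℚ A]

/-- The coefficient `∑_{μ ⊢ j} |Aut μ|⁻¹ ∏ t_{μᵢ}` of `x^j` in `exp (∑ tᵢ xⁱ)`. -/
noncomputable def partitionSum (t : ℕ → A) (j : ℕ) : A :=
  ∑ μ : Nat.Partition j, ((autCard μ : ℚ)⁻¹) • (μ.parts.map t).prod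

theorem partitionSum_zero (t : ℕ → A) : partitionSum t 0 = 1 := by
  rw [partitionSum, Fintype.sum_unique]
  simp [autCard]

theorem autCard_eq_prod {d : ℕ} (μ : Nat.Partition d) {s : Finset ℕ} (hs : μ.parts.toFinset ⊆ s) :
    autCard μ = ∏ i ∈ s, (μ.parts.count i)! := by
  refine Finset.prod_subset hs fun i _ hi => ?_
  rw [Multiset.count_eq_zero_of_notMem (fun h => hi (Multiset.mem_toFinset.2 h)),
    Nat.factorial_zero]

theorem autCard_of_parts_eq_cons {d e i : ℕ} {μ : Nat.Partition d} {ν : Nat.Partition e}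
    (h : μ.parts = i ::ₘ ν.parts) : autCard μ = μ.parts.count i * autCard ν := by
  have hs : ν.parts.toFinset ⊆ μ.parts.toFinset := by
    rw [h, Multiset.toFinset_cons]; exact Finset.subset_insert _ _
  have hi : i ∈ μ.parts.toFinset := by rw [h]; simp
  rw [autCard, autCard_eq_prod ν hs, ← Finset.mul_prod_erase _ _ hi, ← Finset.mul_prod_erase _ _ hi,
    ← mul_assoc]
  congr 1
  · rw [h, Multiset.count_cons_self, Nat.factorial_succ]
  · refine Finset.prod_congr rfl fun k hk => ?_
    rw [h, Multiset.count_cons_of_ne (Finset.ne_of_mem_erase hk)]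

theorem sum_count_smul (t : ℕ → A) {i : ℕ} (hi : 0 < i) (j : ℕ) :
    ∑ μ : Nat.Partition (j + i),
      (μ.parts.count i : ℚ) • ((autCard μ : ℚ)⁻¹) • (μ.parts.map t).prod =
        t i * partitionSum t j := by
  rw [partitionSum, Finset.mul_sum]
  let addPart : Nat.Partition j → Nat.Partition (j + i) := fun ν =>
    ⟨i ::ₘ ν.parts, fun hk => (Multiset.mem_cons.1 hk).elim (· ▸ hi) ν.parts_pos, by
      rw [Multiset.sum_cons, ν.parts_sum, add_comm]⟩
  symm
  refine Finset.sum_of_injOn addPart ?_ (fun _ _ => by simp) ?_ ?_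
  · intro ν _ ν' _ h
    exact Nat.Partition.ext ((Multiset.cons_inj_right i).1 (congrArg Nat.Partition.parts h))
  · intro μ _ hμ
    rw [Multiset.count_eq_zero_of_notMem, Nat.cast_zero, zero_smul]
    intro hmem
    obtain ⟨u, hu⟩ := Multiset.exists_cons_of_mem hmem
    refine hμ ⟨⟨u, fun hk => μ.parts_pos (hu ▸ Multiset.mem_cons_of_mem hk), ?_⟩, by simp,
      Nat.Partition.ext hu.symm⟩
    have := μ.parts_sum
    rw [hu, Multiset.sum_cons] at this
    omega
  · intro ν _
    have hparts : (addPart ν).parts = i ::ₘ ν.parts := rfl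
    have hcount : ((addPart ν).parts.count i : ℚ) ≠ 0 := by
      rw [hparts, Multiset.count_cons_self]; positivity
    rw [autCard_of_parts_eq_cons hparts, smul_smul, Nat.cast_mul, mul_inv,
      mul_inv_cancel_left₀ hcount, hparts, Multiset.map_cons, Multiset.prod_cons, mul_smul_comm]

theorem sum_succ_mul_count_succ {j : ℕ} (μ : Nat.Partition j) :
    ∑ i ∈ Finset.range j, (i + 1) * μ.parts.count (i + 1) = j := by
  have hsub : μ.parts.toFinset ⊆ Finset.range (j + 1) := fun i hi => by
    have := Multiset.single_le_sum (fun _ _ => Nat.zero_le _) i (Multiset.mem_toFinset.1 hi)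
    rw [μ.parts_sum] at this
    exact Finset.mem_range.2 (Nat.lt_succ_of_le this)
  conv_rhs => rw [← μ.parts_sum, ← Multiset.map_id μ.parts,
    Finset.sum_multiset_map_count μ.parts id]
  rw [Finset.sum_subset hsub, Finset.sum_range_succ']
  · simp [mul_comm]
  · intro i _ hi
    rw [Multiset.count_eq_zero_of_notMem (fun h => hi (Multiset.mem_toFinset.2 h)), zero_smul]

theorem partitionSum_succ (t : ℕ → A) (j : ℕ) :
    ((j : ℚ) + 1) • partitionSum t (j + 1) =
      ∑ i ∈ Finset.range (j + 1), ((i : ℚ) + 1) • (t (i + 1) * partitionSum t (j - i)) := by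
  have hcount : ∀ i ∈ Finset.range (j + 1), ((i : ℚ) + 1) • (t (i + 1) * partitionSum t (j - i)) =
      ∑ μ : Nat.Partition (j + 1), (((i : ℚ) + 1) * (μ.parts.count (i + 1) : ℚ)) •
        ((autCard μ : ℚ)⁻¹) • (μ.parts.map t).prod := by
    intro i hi
    obtain ⟨l, rfl⟩ := Nat.exists_eq_add_of_le' (Nat.lt_succ_iff.1 (Finset.mem_range.1 hi))
    rw [Nat.add_sub_cancel, add_assoc, ← sum_count_smul t i.succ_pos l, Finset.smul_sum]
    simp only [smul_smul, mul_assoc]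
  rw [Finset.sum_congr rfl hcount, Finset.sum_comm, partitionSum, Finset.smul_sum]
  refine Finset.sum_congr rfl fun μ _ => ?_
  rw [← Finset.sum_smul]
  congr 1
  exact_mod_cast (sum_succ_mul_count_succ μ).symm

open PowerSeries in
theorem coeff_eq_partitionSum {f l : A⟦X⟧} (hf : constantCoeff f = 1)
    (h : derivative A f = f * derivative A l) (m : ℕ) :
    coeff m f = partitionSum (fun i => coeff i l) m := by
  induction m using Nat.strong_induction_on with
  | _ m ih =>
    cases m with
    | zero => rw [partitionSum_zero, coeff_zero_eq_constantCoeff_apply, hf]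
    | succ m =>
      have hm : ((m : ℚ) + 1) ≠ 0 := by positivity
      have hcoeff := congrArg (coeff m) h
      rw [mul_comm f, coeff_mul, Finset.Nat.sum_antidiagonal_eq_sum_range_succ_mk] at hcoeff
      simp only [coeff_derivative] at hcoeff
      suffices hsmul : ((m : ℚ) + 1) • coeff (m + 1) f =
          ((m : ℚ) + 1) • partitionSum (fun i => coeff i l) (m + 1) from
        smul_right_injective A hm hsmul
      rw [partitionSum_succ]
      simp only [Algebra.smul_def, map_add, map_natCast, map_one]
      rw [mul_comm, hcoeff]
      refine Finset.sum_congr rfl fun i _ => ?_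
      rw [ih (m - i) (by omega)]
      ring

theorem double_injective (j : ℕ) : Function.Injective (double (d := j)) := fun _ _ h =>
  Nat.Partition.ext (Multiset.map_injective (mul_right_injective₀ two_ne_zero)
    (congrArg Nat.Partition.parts h))

theorem autCard_double {j : ℕ} (μ : Nat.Partition j) : autCard (double μ) = autCard μ := by
  have hinj : Function.Injective (2 * · : ℕ → ℕ) := mul_right_injective₀ two_ne_zero
  change ∏ i ∈ (μ.parts.map (2 * ·)).toFinset, ((μ.parts.map (2 * ·)).count i)! = autCard μ
  rw [Multiset.toFinset_map, Finset.prod_image hinj.injOn]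
  exact Finset.prod_congr rfl fun i _ => by rw [Multiset.count_map_eq_count' _ _ hinj]

theorem exists_double_eq {j : ℕ} {μ : Nat.Partition (2 * j)} (hμ : ∀ i ∈ μ.parts, Even i) :
    ∃ ν : Nat.Partition j, double ν = μ := by
  have hparts : (μ.parts.map (· / 2)).map (2 * ·) = μ.parts := by
    rw [Multiset.map_map]
    conv_rhs => rw [← Multiset.map_id μ.parts]
    exact Multiset.map_congr rfl fun i hi => Nat.two_mul_div_two_of_even (hμ i hi)
  refine ⟨⟨μ.parts.map (· / 2), fun {_} hi => ?_, ?_⟩, Nat.Partition.ext hparts⟩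
  · obtain ⟨k, hk, rfl⟩ := Multiset.mem_map.1 hi
    have := μ.parts_pos hk
    have := Nat.two_mul_div_two_of_even (hμ k hk)
    omega
  · have := μ.parts_sum
    rw [← hparts, Multiset.sum_map_mul_left, Multiset.map_id'] at this
    omega

theorem partitionSum_two_mul {t : ℕ → A} (ht : ∀ i, Odd i → t i = 0) (j : ℕ) :
    partitionSum t (2 * j) =
      ∑ μ : Nat.Partition j, ((autCard μ : ℚ)⁻¹) • ((double μ).parts.map t).prod := by
  symm
  refine Finset.sum_of_injOn double (double_injective j).injOn (fun _ _ => by simp) ?_ ?_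
  · intro μ _ hμ
    obtain ⟨i, hi, hodd⟩ : ∃ i ∈ μ.parts, Odd i := by
      by_contra! h
      obtain ⟨ν, hν⟩ := exists_double_eq fun i hi => Nat.not_odd_iff_even.1 (h i hi)
      exact hμ ⟨ν, by simp, hν⟩
    rw [Multiset.prod_eq_zero (Multiset.mem_map.2 ⟨i, hi, ht i hodd⟩), smul_zero]
  · intro μ _
    rw [autCard_double]

end PartitionSum

section SinhProd

open PowerSeries

theorem rescale_neg_one_sinhDivX : rescale (-1) sinhDivX = sinhDivX := by
  ext m
  rw [coeff_rescale, sinhDivX, coeff_mk]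
  split_ifs with hm
  · rw [hm.neg_one_pow, one_mul]
  · rw [mul_zero]

theorem xi_of_odd {m : ℕ} (hm : Odd m) : xi m = 0 := by
  have h := congrArg (coeff m) (rescale_logOf (-1) constantCoeff_sinhDivX)
  rw [rescale_neg_one_sinhDivX, coeff_rescale, hm.neg_one_pow] at h
  rw [xi]
  linarith

theorem constantCoeff_rescale_map_sinhDivX {A : Type*} [CommRing A] (e : ℚ →+* A) (a : A) :
    constantCoeff (rescale a (map e sinhDivX)) = 1 := by
  rw [← coeff_zero_eq_constantCoeff_apply, coeff_rescale, coeff_map,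
    coeff_zero_eq_constantCoeff_apply, constantCoeff_sinhDivX, map_one, pow_zero, one_mul]

theorem derivative_sinhProd (n : ℕ) :
    derivative (MvPolynomial (Fin n) ℚ) (sinhProd n) = sinhProd n *
      derivative (MvPolynomial (Fin n) ℚ)
        (∑ i, rescale (MvPolynomial.X i) (map MvPolynomial.C (logOf sinhDivX))) := by
  rw [sinhProd, map_sum]
  refine derivation_prod_eq_prod_mul_sum _ _ fun i _ => ?_
  rw [derivative_rescale, derivative_rescale, derivative_map, derivative_map,
    derivative_eq_mul_derivative_logOf constantCoeff_sinhDivX, map_mul, map_mul, mul_left_comm]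

theorem coeff_sum_rescale_logOf_sinhDivX (n m : ℕ) :
    coeff m (∑ i : Fin n, rescale (MvPolynomial.X i)
      (map (MvPolynomial.C : ℚ →+* MvPolynomial (Fin n) ℚ) (logOf sinhDivX))) =
      MvPolynomial.C (xi m) * MvPolynomial.psum (Fin n) ℚ m := by
  simp only [map_sum, coeff_rescale, coeff_map, ← Finset.sum_mul, MvPolynomial.psum, xi]
  rw [mul_comm]

theorem coeff_sinhProd (n j : ℕ) :
    coeff (2 * j) (sinhProd n) = ∑ μ : Nat.Partition j,
      MvPolynomial.C (xiPart (double μ) / (autCard μ : ℚ)) *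
        MvPolynomial.psumPart (Fin n) ℚ (double μ) := by
  have hconst : constantCoeff (sinhProd n) = 1 := by
    rw [sinhProd, map_prod]
    exact Finset.prod_eq_one fun i _ => constantCoeff_rescale_map_sinhDivX _ _
  rw [coeff_eq_partitionSum hconst (derivative_sinhProd n)]
  simp only [coeff_sum_rescale_logOf_sinhDivX]
  rw [partitionSum_two_mul fun i hi => by rw [xi_of_odd hi, map_zero, zero_mul]]
  refine Finset.sum_congr rfl fun μ _ => ?_
  rw [Multiset.prod_map_mul, MvPolynomial.smul_eq_C_mul, ← mul_assoc, div_eq_inv_mul, map_mul,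
    xiPart, map_multiset_prod, Multiset.map_map]
  rfl

end SinhProd

section TopCoefficients

open MvPolynomial

variable {n : ℕ}

theorem isHomogeneous_coeff_prod {σ R ι : Type*} [CommSemiring R] (s : Finset ι)
    {f : ι → PowerSeries (MvPolynomial σ R)}
    (hf : ∀ i ∈ s, ∀ m, (PowerSeries.coeff m (f i)).IsHomogeneous m) (m : ℕ) :
    (PowerSeries.coeff m (∏ i ∈ s, f i)).IsHomogeneous m := by
  classical
  rw [PowerSeries.coeff_prod]
  refine IsHomogeneous.sum _ _ _ fun l hl => ?_
  rw [← (Finset.mem_finsuppAntidiag.1 hl).1]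
  exact IsHomogeneous.prod _ _ _ fun i hi => hf i hi _

theorem isHomogeneous_coeff_sinhProd (n m : ℕ) :
    (PowerSeries.coeff m (sinhProd n)).IsHomogeneous m := by
  refine isHomogeneous_coeff_prod _ (fun i _ k => ?_) m
  rw [PowerSeries.coeff_rescale, PowerSeries.coeff_map, mul_comm]
  exact (isHomogeneous_X_pow i k).C_mul _

theorem isHomogeneous_sum_X_pow (σ R : Type*) [Fintype σ] [CommSemiring R] (N : ℕ) :
    ((∑ i, X i : MvPolynomial σ R) ^ N).IsHomogeneous N := by
  have h : (∑ i, X i : MvPolynomial σ R).IsHomogeneous 1 :=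
    IsHomogeneous.sum _ _ _ fun i _ => isHomogeneous_X _ i
  simpa only [one_mul] using h.pow N

-- Only the constant term `1` of `(sinh x / x)⁻¹` contributes in top degree.
theorem coeff_mul_sinhQuot (b : Fin n →₀ ℕ) (N m : ℕ) (hb : b.degree = N + m) :
    coeff b ((∑ i, X i) ^ N * PowerSeries.coeff m (sinhQuot n)) =
      coeff b ((∑ i, X i) ^ N * PowerSeries.coeff m (sinhProd n)) := by
  rw [sinhQuot, PowerSeries.coeff_mul, Finset.mul_sum, coeff_sum,
    Finset.sum_eq_single_of_mem (m, 0) (by simp)]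
  · rw [PowerSeries.coeff_map, PowerSeries.coeff_zero_eq_constantCoeff_apply,
      PowerSeries.constantCoeff_inv, constantCoeff_sinhDivX, inv_one, map_one, mul_one]
  · rintro ⟨p, q⟩ hpq hne
    have hpq' : p + q = m := Finset.HasAntidiagonal.mem_antidiagonal.1 hpq
    have hdegree : b.degree ≠ N + p := fun h => hne (by ext <;> dsimp only <;> omega)
    rw [PowerSeries.coeff_map, ← mul_assoc, mul_comm, coeff_C_mul,
      ((isHomogeneous_sum_X_pow _ _ N).mul (isHomogeneous_coeff_sinhProd n p)).coeff_eq_zero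
        hdegree, mul_zero]

theorem coeff_sum_X_pow {σ R : Type*} [Fintype σ] [CommSemiring R] (c : σ →₀ ℕ) :
    coeff c ((∑ i, X i : MvPolynomial σ R) ^ c.degree) = (Nat.multinomial Finset.univ c : R) := by
  classical
  have hmonomial (k : σ → ℕ) : ∏ i, (X i : MvPolynomial σ R) ^ k i =
      monomial (Finsupp.equivFunOnFinite.symm k) 1 := by
    rw [monomial_eq, map_one, one_mul, Finsupp.prod_fintype _ _ fun i => pow_zero _]
    rfl
  have hc : (c : σ → ℕ) ∈ Finset.piAntidiag Finset.univ c.degree :=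
    Finset.mem_piAntidiag.2 ⟨(Finsupp.degree_eq_sum c).symm, fun i _ => Finset.mem_univ i⟩
  simp only [Finset.sum_pow_eq_sum_piAntidiag, coeff_sum, hmonomial,
    ← map_natCast (C (σ := σ) (R := R)), coeff_C_mul, coeff_monomial]
  rw [Finset.sum_eq_single_of_mem _ hc]
  · rw [if_pos (Finsupp.equivFunOnFinite_symm_coe c), mul_one]
  · intro k _ hk
    rw [if_neg (by rintro rfl; exact hk rfl), mul_zero]

theorem psumPart_eq_prod (σ R : Type*) [Fintype σ] [CommSemiring R] {k : ℕ}
    (μ : Nat.Partition k) :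
    psumPart σ R μ = ∏ i : Fin (partList μ).length, psum σ R ((partList μ).get i) := by
  rw [psumPart, ← partList_coe, Multiset.map_coe, Multiset.prod_coe]
  simp

theorem coeff_psumPart {σ R : Type*} [Fintype σ] [DecidableEq σ] [CommSemiring R] {k : ℕ}
    (μ : Nat.Partition k) (a : σ →₀ ℕ) :
    coeff a (psumPart σ R μ) = (Nat.card {f : Fin (partList μ).length → σ //
      ∀ x, ∑ i with f i = x, (partList μ).get i = a x} : R) := by
  have hmonomial (f : Fin (partList μ).length → σ) :
      ∏ i, (X (f i) : MvPolynomial σ R) ^ (partList μ).get i =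
        monomial (∑ i, Finsupp.single (f i) ((partList μ).get i)) 1 := by
    rw [monomial_sum_one]
    exact Finset.prod_congr rfl fun i _ => X_pow_eq_monomial
  have hexp (f : Fin (partList μ).length → σ) :
      ∑ i, Finsupp.single (f i) ((partList μ).get i) = a ↔
        ∀ x, ∑ i with f i = x, (partList μ).get i = a x := by
    simp only [Finsupp.ext_iff, Finsupp.finsetSum_apply, Finset.sum_filter, Finsupp.single_apply]
  simp only [psumPart_eq_prod, psum, Finset.prod_univ_sum, Fintype.piFinset_univ, coeff_sum,
    hmonomial, coeff_monomial, hexp]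
  rw [Nat.card_eq_fintype_card, Fintype.card_subtype, Finset.card_filter, Nat.cast_sum]
  exact Finset.sum_congr rfl fun f _ => by rw [Nat.cast_ite, Nat.cast_one, Nat.cast_zero]

theorem coeff_psumPart_eq_R {R' : Type*} [CommSemiring R'] {k : ℕ} (μ : Nat.Partition k)
    (a : Fin n →₀ ℕ) : coeff a (psumPart (Fin n) R' μ) = (R μ (ofVec a) : R') := by
  have hparts : (Finsupp.toMultiset a).dedup.map a = (partList (ofVec a) : Multiset ℕ) := by
    have hdedup : (Finsupp.toMultiset a).dedup = (Finset.univ.filter fun i => a i ≠ 0).val := by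
      rw [← Multiset.toFinset_val, Finsupp.toFinset_toMultiset]
      congr 1
      ext i
      simp
    rw [partList_coe, ofVec_parts_eq_filter, hdedup, Finset.filter_val, Multiset.filter_map]
    rfl
  rw [coeff_psumPart, Nat.card_eq_fintype_card, R,
    ← card_maps_eq (partList μ) (partList (ofVec a)) (partList_pos μ)
    (Finsupp.toMultiset a) (by simpa only [Finsupp.count_toMultiset] using hparts)]
  simp only [Finsupp.count_toMultiset]

theorem coeff_psumPart_double_eq_zero {k : ℕ} (μ : Nat.Partition k) (a : Fin n →₀ ℕ)
    (h : ¬((∀ i, Even (a i)) ∧ ∑ i, a i = 2 * k)) :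
    coeff a (psumPart (Fin n) ℚ (double μ)) = 0 := by
  have heven : ∀ i, Even ((partList (double μ)).get i) := fun i => by
    have hmem : (partList (double μ)).get i ∈ (double μ).parts :=
      partList_coe (double μ) ▸ List.get_mem _ i
    obtain ⟨j, -, hj⟩ := Multiset.mem_map.1 hmem
    exact hj ▸ even_two_mul j
  have hsum : ∑ i, (partList (double μ)).get i = 2 * k := by
    have hparts := (double μ).parts_sum
    rw [← partList_coe, Multiset.sum_coe] at hparts
    simpa using hparts
  rw [coeff_psumPart, Nat.cast_eq_zero, Finite.card_eq_zero_iff]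
  refine ⟨fun ⟨f, hf⟩ => h ⟨fun x => ?_, ?_⟩⟩
  · rw [← hf x]
    exact Finset.even_sum _ fun i _ => heven i
  · rw [← Finset.sum_congr rfl fun x _ => hf x, Finset.sum_fiberwise, hsum]

theorem mem_D {m : ℕ} {a b : Fin n → ℕ} :
    a ∈ D m b ↔ a ≤ b ∧ (∀ i, Even (a i)) ∧ ∑ i, a i = m := by
  simp [D, Pi.le_def]

theorem coeff_pow_mul_psumPart_double {k : ℕ} (μ : Nat.Partition k) (b : Fin n → ℕ) (N : ℕ)
    (hb : ∑ i, b i = N + 2 * k) :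
    coeff (Finsupp.equivFunOnFinite.symm b)
      ((∑ i, X i) ^ N * psumPart (Fin n) ℚ (double μ)) =
      ∑ a ∈ D (2 * k) b, (R (double μ) (ofVec a) : ℚ) *
        (Nat.multinomial Finset.univ (fun i => b i - a i) : ℚ) := by
  classical
  let e : (Fin n →₀ ℕ) ≃ (Fin n → ℕ) := Finsupp.equivFunOnFinite
  rw [mul_comm, coeff_mul]
  symm
  refine Finset.sum_of_injOn (fun a => (e.symm a, e.symm (b - a))) ?_ ?_ ?_ ?_
  · exact fun a _ a' _ h => e.symm.injective (congrArg Prod.fst h)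
  · intro a ha
    rw [Finset.mem_coe, Finset.HasAntidiagonal.mem_antidiagonal]
    exact e.injective (add_tsub_cancel_of_le (mem_D.1 ha).1)
  · rintro ⟨p, q⟩ hpq hne
    have hadd : e p + e q = b := congrArg e (Finset.HasAntidiagonal.mem_antidiagonal.1 hpq)
    rw [coeff_psumPart_double_eq_zero, zero_mul]
    refine fun h => hne ⟨e p, mem_D.2 ⟨hadd ▸ le_self_add, h⟩, ?_⟩
    simp only [← hadd, add_tsub_cancel_left, Equiv.symm_apply_apply]
  · intro a ha
    obtain ⟨hle, -, hsum⟩ := mem_D.1 ha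
    have hdegree : (e.symm (b - a)).degree = N := by
      have hadd : ∑ i, (b - a) i + ∑ i, a i = ∑ i, b i := by
        rw [← Finset.sum_add_distrib]
        exact Finset.sum_congr rfl fun i _ => Nat.sub_add_cancel (hle i)
      rw [Finsupp.degree_eq_sum]
      change ∑ i, (b - a) i = N
      omega
    rw [coeff_psumPart_eq_R, ← hdegree, coeff_sum_X_pow]
    rfl

theorem coeff_explicitPolynomial (g r : ℕ) (b : Fin (2 * r + 1) → ℕ)
    (hb : ∑ i, b i = 3 * g + r) :
    (explicitPolynomial g r).coeff (Finsupp.equivFunOnFinite.symm b) =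
      1 / (2 : ℚ) ^ (3 * g + r) *
        ∑ h ∈ Finset.range (g + 1),
          ((2 * (g + r) - 2 * h)! : ℚ) / ((h ! : ℚ) * ((g + r - h)! : ℚ) * 3 ^ h) *
            ∑ lam : Nat.Partition (g - h), ∑ a ∈ D (2 * g - 2 * h) b,
              xiPart (double lam) * (R (double lam) (ofVec a) : ℚ) / (autCard lam : ℚ) *
                (Nat.multinomial Finset.univ (fun i => b i - a i) : ℚ) := by
  rw [explicitPolynomial, coeff_C_mul, coeff_sum]
  congr 1
  refine Finset.sum_congr rfl fun h hh => ?_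
  have hhg : h ≤ g := Nat.lt_succ_iff.1 (Finset.mem_range.1 hh)
  have hsum : ∑ i, b i = (g + r + 2 * h) + 2 * (g - h) := by omega
  rw [coeff_C_mul, coeff_mul_sinhQuot _ _ _ ((Finsupp.degree_eq_sum _).trans hsum),
    coeff_sinhProd, Finset.mul_sum, coeff_sum, ← Nat.mul_sub 2 g h]
  congr 1
  refine Finset.sum_congr rfl fun lam _ => ?_
  rw [mul_left_comm, coeff_C_mul, coeff_pow_mul_psumPart_double lam b _ hsum, Finset.mul_sum]
  exact Finset.sum_congr rfl fun a _ => by ring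

theorem IsHurwitzPolynomial.unique {g : ℕ} {P Q : MvPolynomial (Fin n) ℚ}
    (hP : IsHurwitzPolynomial g n P) (hQ : IsHurwitzPolynomial g n Q) : P = Q := by
  let pos : Set ℚ := (fun k : ℕ => (k : ℚ)) '' Set.Ioi 0
  have hpos : pos.Infinite := (Set.Ioi_infinite 0).image Nat.cast_injective.injOn
  refine funext_set (fun _ => pos) (fun _ => hpos) fun x hx => ?_
  choose β hβ hβx using fun i => hx i (Set.mem_univ i)
  obtain rfl : (fun i => (β i : ℚ)) = x := funext hβx
  rw [hP β hβ, hQ β hβ]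

theorem hurwitzPolynomial_eq {g : ℕ} {P : MvPolynomial (Fin n) ℚ}
    (hP : IsHurwitzPolynomial g n P) : hurwitzPolynomial g n = P := by
  have hex : ∃ P, IsHurwitzPolynomial g n P := ⟨P, hP⟩
  rw [hurwitzPolynomial, dif_pos hex]
  exact hex.choose_spec.unique hP

end TopCoefficients

end HurwitzHodge

open HurwitzHodge in
theorem proposition4p4 (g n : ℕ) (hn : Odd n) (b : Fin n → ℕ)
    (hb : ∑ i, b i = 3 * g + (n - 1) / 2) (s : ℕ) (hs : s = g + (n - 1) / 2) :
    (∃! P : MvPolynomial (Fin n) ℚ, IsHurwitzPolynomial g n P) ∧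
    wittenTerm g b =
      1 / (2 : ℚ) ^ (3 * g + (n - 1) / 2) *
        ∑ h ∈ Finset.range (g + 1),
          ((2 * s - 2 * h)! : ℚ) / ((h ! : ℚ) * ((s - h)! : ℚ) * 3 ^ h) *
            ∑ lam : Nat.Partition (g - h), ∑ a ∈ D (2 * g - 2 * h) b,
              xiPart (double lam) * (R (double lam) (ofVec a) : ℚ) / (autCard lam : ℚ) *
                (Nat.multinomial Finset.univ (fun i => b i - a i) : ℚ) := by
  obtain ⟨r, rfl⟩ := hn
  have hr : (2 * r + 1 - 1) / 2 = r := by omega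
  have hP := isHurwitzPolynomial_explicitPolynomial g r
  refine ⟨⟨explicitPolynomial g r, hP, fun Q hQ => hQ.unique hP⟩, ?_⟩
  rw [wittenTerm, combHodge, mul_zero, add_zero, if_pos hb, pow_zero, one_mul,
    hurwitzPolynomial_eq hP]
  rw [hr] at hb hs ⊢
  rw [hs, coeff_explicitPolynomial g r b hb]
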